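/- Let $K$ be an algebraically closed field of prime characteristic $p \neq 2,3$, let $A,B\in K$ with $4A^3+27B^2\neq 0$, and let $E : y^2=x^3+Ax+B$. Let $\tilde E(K[\varepsilon])$, $\varepsilon^2=0$, be the group of points $(X:Y:Z)$ of the same equation $Y^2Z=X^3+AXZ^2+BZ^3$ over the dual numbers $K[\varepsilon]$; it contains $E(K)$ and the group of points at infinity $\Theta=\{\mathcal O_k=(k\varepsilon:1:0) : k\in K\}$. Let $O = \mathcal O_0$. Let $R\in E[p]$ with $R\notin E[2]$ (so $E$ is ordinary), and let $T$ be a point of order two. For $P\in E[p]$, $P\neq O$, and $i,j \geq 1$ with $i+j\le p$ let $\ell_{i,j}$ be the line through $iP$ and $jP$ (the tangent line if $iP=jP$), written $y-mx-b$ if $i+j \neq p$, let $v_i=x-x(iP)$, let $\tau$ be translation by $-T$, and put $h_{i,j}=(\ell_{i,j}/v_{i+j})\circ\tau$ if $i+j\neq p$ and $h_{i,j}=v_i\circ\tau$ if $i+j=p$. An addition chain for $p$ is a set $S\subseteq\{1,\dots,p\}$ containing $p$ in which each $k>1$ is a sum of two members of $S$; an addition chain decomposition $C$ of $p$ is a finite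 sequence of steps $(i+j\mapsto i,j)$ with $i,j,i+j\in S$, for an addition chain $S$ for $p$, which decomposes $p$ into a sum of $p$ ones. Define, for $P\in E[p]$ and $k\in K$, $$e(P,\mathcal O_k)=\prod_{(i+j\mapsto i,j)\in C}\frac{h_{i,j}(\mathcal O_k+R)}{h_{i,j}(R)}\quad\text{if } P\neq O \text{ and } k\neq 0,\qquad e(P,\mathcal O_k)=1 \quad\text{if } P=O\text{ or }k=0.$$ Then: 1. $e$ is a well-defined map $E[p]\times\Theta\to\mu_p(K[\varepsilon])$: each $h_{i,j}$ occurring in the product is evaluated, after translation, at affine points of $\tilde E(K[\varepsilon])$ where its denominator is invertible, each $h_{i,j}(R)$ is invertible, and the values of $e$ are $p$-th roots of unity. 2. $e$ does not depend on the addition chain decomposition $C$ of $p$. 3. $e$ is bilinear: $e(P+P',Q)=e(P,Q)\,e(P',Q)$ and $e(P,Q+Q')=e(P,Q)\,e(P,Q')$ for $P,P'\in E[p]$ and $Q,Q'\in\Theta$. 4. Let $P\in E[p]$, let $D_P$ be any divisor of degree $0$ on $E$ that sums to $P$, let $f_P$ be any function on $E$ with divisor $pD_P$, and let $f_P'=\frac{d}{dx}f_P$.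 Then for every $R'\in E(K)$ the function $y f_P'/f_P$ is regular at $R'$, and for all $k\in K$ $$e(P,\mathcal O_k)=1-2\Big(y\,\frac{f_P'}{f_P}\Big)(R')\,k\,\varepsilon .$$ In particular $e$ does not depend on the choice of $R$ or of $T$. -/

import Mathlib

open scoped DualNumber
open WeierstrassCurve.Projective (PointClass)

namespace DualPairing

/-! ### The curve and its points over a commutative ring -/

section Curve

variable {S : Type*} [CommRing S]

/-- The Weierstrass curve `y² = x³ + a x + b` over a commutative ring. -/
abbrev curve (a b : S) : WeierstrassCurve.Affine S :=
  { a₁ := 0, a₂ := 0, a₃ := 0, a₄ := a, a₆ := b }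

/-- The first of two bihomogeneous addition laws on `Y²Z = X³ + aXZ² + bZ³`. At a pair `(P, Q)` of
points of an elliptic curve over a field it is nonzero exactly when `P ≠ Q`, and then it gives `P + Q`. -/
def addLaw₁ (a b : S) (P Q : Fin 3 → S) : Fin 3 → S :=
  ![(P 0 * Q 1 - Q 0 * P 1) * (P 1 * Q 2 + Q 1 * P 2)
      + (P 0 * Q 2 - Q 0 * P 2) * P 1 * Q 1
      - a * (P 0 * Q 2 + Q 0 * P 2) * (P 0 * Q 2 - Q 0 * P 2)
      - 3 * b * (P 0 * Q 2 - Q 0 * P 2) * P 2 * Q 2,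
    -3 * P 0 * Q 0 * (P 0 * Q 1 - Q 0 * P 1)
      - P 1 * Q 1 * (P 1 * Q 2 - Q 1 * P 2)
      - a * (P 0 * Q 1 - Q 0 * P 1) * P 2 * Q 2
      + a * (P 0 * Q 2 + Q 0 * P 2) * (P 1 * Q 2 - Q 1 * P 2)
      + 3 * b * (P 1 * Q 2 - Q 1 * P 2) * P 2 * Q 2,
    3 * P 0 * Q 0 * (P 0 * Q 2 - Q 0 * P 2)
      - (P 1 * Q 2 + Q 1 * P 2) * (P 1 * Q 2 - Q 1 * P 2)
      + a * (P 0 * Q 2 - Q 0 * P 2) * P 2 * Q 2]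

/-- The second of two bihomogeneous addition laws on `Y²Z = X³ + aXZ² + bZ³`. At a pair `(P, Q)` of
points of an elliptic curve over a field it is nonzero exactly when `P - Q` is not of order two, and then it gives
`P + Q`. -/
def addLaw₂ (a b : S) (P Q : Fin 3 → S) : Fin 3 → S :=
  ![P 1 * Q 1 * (P 0 * Q 1 + Q 0 * P 1)
      - a * P 0 * Q 0 * (P 1 * Q 2 + Q 1 * P 2)
      - a * (P 0 * Q 1 + Q 0 * P 1) * (P 0 * Q 2 + Q 0 * P 2)
      - 3 * b * (P 0 * Q 1 + Q 0 * P 1) * P 2 * Q 2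
      - 3 * b * (P 0 * Q 2 + Q 0 * P 2) * (P 1 * Q 2 + Q 1 * P 2)
      + a ^ 2 * (P 1 * Q 2 + Q 1 * P 2) * P 2 * Q 2,
    P 1 ^ 2 * Q 1 ^ 2 + 3 * a * P 0 ^ 2 * Q 0 ^ 2
      + 9 * b * P 0 * Q 0 * (P 0 * Q 2 + Q 0 * P 2)
      - a ^ 2 * P 0 * Q 2 * (P 0 * Q 2 + 2 * Q 0 * P 2)
      - a ^ 2 * Q 0 * P 2 * (2 * P 0 * Q 2 + Q 0 * P 2)
      - 3 * a * b * P 2 * Q 2 * (P 0 * Q 2 + Q 0 * P 2)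
      - (a ^ 3 + 9 * b ^ 2) * P 2 ^ 2 * Q 2 ^ 2,
    3 * P 0 * Q 0 * (P 0 * Q 1 + Q 0 * P 1)
      + P 1 * Q 1 * (P 1 * Q 2 + Q 1 * P 2)
      + a * (P 0 * Q 1 + Q 0 * P 1) * P 2 * Q 2
      + a * (P 0 * Q 2 + Q 0 * P 2) * (P 1 * Q 2 + Q 1 * P 2)
      + 3 * b * (P 1 * Q 2 + Q 1 * P 2) * P 2 * Q 2]

lemma addLaw₁_smul (a b u v : S) (P Q : Fin 3 → S) :
    addLaw₁ a b (u • P) (v • Q) = (u * v) ^ 2 • addLaw₁ a b P Q := by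
  ext i
  fin_cases i <;> simp [addLaw₁] <;> ring

lemma addLaw₂_smul (a b u v : S) (P Q : Fin 3 → S) :
    addLaw₂ a b (u • P) (v • Q) = (u * v) ^ 2 • addLaw₂ a b P Q := by
  ext i
  fin_cases i <;> simp [addLaw₂] <;> ring

/-- Over a local ring: `(X, Y, Z)` generates the unit ideal, so it represents a point of `ℙ²`. -/
def IsPrimitive (P : Fin 3 → S) : Prop :=
  ∃ i, IsUnit (P i)

lemma isPrimitive_smul {u : S} (hu : IsUnit u) (P : Fin 3 → S) :
    IsPrimitive (u • P) ↔ IsPrimitive P := by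
  simp [IsPrimitive, hu]

open Classical in
/-- Addition of representatives of points over a local ring: the first addition law where it is
defined, the second one otherwise. -/
noncomputable def addRep (a b : S) (P Q : Fin 3 → S) : Fin 3 → S :=
  if IsPrimitive (addLaw₁ a b P Q) then addLaw₁ a b P Q else addLaw₂ a b P Q

lemma addRep_smul (a b : S) {u v : S} (hu : IsUnit u) (hv : IsUnit v) (P Q : Fin 3 → S) :
    addRep a b (u • P) (v • Q) = (u * v) ^ 2 • addRep a b P Q := by
  by_cases h : IsPrimitive (addLaw₁ a b P Q) <;>
    simp [addRep, addLaw₁_smul, addLaw₂_smul, isPrimitive_smul ((hu.mul hv).pow 2), h]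

/-- The addition of classes `(X : Y : Z)` over a local ring. On points of the curve it is the group
law of the curve. -/
noncomputable def addClass (a b : S) (P Q : PointClass S) : PointClass S :=
  Quotient.map₂ (addRep a b) (by
    rintro _ P ⟨u, rfl⟩ _ Q ⟨v, rfl⟩
    refine ⟨(u * v) ^ 2, ?_⟩
    simpa [Units.smul_def] using (addRep_smul a b u.isUnit v.isUnit P Q).symm) P Q

/-- The points `(X : Y : Z)` of `Y²Z = X³ + aXZ² + bZ³` over a local ring. -/
def points (a b : S) : Set (PointClass S) :=
  {P | ∃ X : Fin 3 → S, P = ⟦X⟧ ∧ IsPrimitive X ∧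
    WeierstrassCurve.Projective.Equation (curve a b) X}

end Curve

section Field

variable {K : Type*} [Field K] {A B : K}

/-- Projective coordinates of a point of `E : y² = x³ + A x + B` over the field `K`. -/
def coords : (curve A B).Point → Fin 3 → K
  | .zero => ![0, 1, 0]
  | .some x y _ => ![x, y, 1]

/-! ### The canonical lift `Ẽ` to the dual numbers -/

/-- The point at infinity `O_k = (kε : 1 : 0)`. -/
def infPt (k : K) : PointClass K[ε] :=
  ⟦![k • DualNumber.eps, 1, 0]⟧

/-- The set `Θ` of the points at infinity. -/
def Θ (K : Type*) [Field K] : Set (PointClass K[ε]) :=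
  Set.range infPt

/-- A point of `E(K)`, regarded as a point of the canonical lift. -/
def liftPt (P : (curve A B).Point) : PointClass K[ε] :=
  ⟦fun i => algebraMap K K[ε] (coords P i)⟧

/-- The points of the canonical lift `Ẽ(K[ε])`. -/
def dualPoints (A B : K) : Set (PointClass K[ε]) :=
  points (algebraMap K K[ε] A) (algebraMap K K[ε] B)

/-- The addition of the canonical lift `Ẽ(K[ε])`. -/
noncomputable def dualAdd (A B : K) (P Q : PointClass K[ε]) : PointClass K[ε] :=
  addClass (algebraMap K K[ε] A) (algebraMap K K[ε] B) P Q

/-! ### Lines and the functions `h_{i,j}` -/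

/-- The linear form `L 0 * X + L 1 * Y + L 2 * Z`, evaluated over the dual numbers. -/
def evalForm (L : Fin 3 → K) (X : Fin 3 → K[ε]) : K[ε] :=
  ∑ i, algebraMap K K[ε] (L i) * X i

lemma evalForm_smul (L : Fin 3 → K) (u : K[ε]) (X : Fin 3 → K[ε]) :
    evalForm L (u • X) = u * evalForm L X := by
  simp only [evalForm, Finset.mul_sum, Pi.smul_apply, smul_eq_mul]
  exact Finset.sum_congr rfl fun _ _ => by ring

/-- The value at a point over `K[ε]` of the function `N / D`, for linear forms `N` and `D`. It is
meaningful where `D` is invertible, see `RatioDefined`. -/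
noncomputable def ratio (N D : Fin 3 → K) (Q : PointClass K[ε]) : K[ε] :=
  Quotient.lift (fun X => evalForm N X * Ring.inverse (evalForm D X)) (by
    rintro _ X ⟨u, rfl⟩
    simp only [Units.smul_def, evalForm_smul, Ring.mul_inverse_rev, Ring.inverse_unit]
    linear_combination (evalForm N X * Ring.inverse (evalForm D X)) * u.mul_inv) Q

/-- The denominator of `N / D` is invertible at a point over `K[ε]`. -/
def RatioDefined (D : Fin 3 → K) (Q : PointClass K[ε]) : Prop :=
  ∃ X : Fin 3 → K[ε], Q = ⟦X⟧ ∧ IsUnit (evalForm D X)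

/-- The vertical line through `P`, namely `x - x(P) = 0` (the line at infinity if `P = O`). -/
def vertical : (curve A B).Point → Fin 3 → K
  | .zero => ![0, 0, 1]
  | .some x _ _ => ![1, 0, -x]

variable [DecidableEq K]

/-- The line through `P` and `Q`, the tangent line if `P = Q`: it is `y - y₁ - m (x - x₁) = 0` for
the slope `m`, or a vertical line if `P + Q = O` or one of `P`, `Q` is `O`. -/
def line : (curve A B).Point → (curve A B).Point → Fin 3 → K
  | .zero, Q => vertical Q
  | P, .zero => vertical P
  | .some x₁ y₁ _, .some x₂ y₂ _ =>
    if x₁ = x₂ ∧ y₁ = -y₂ then ![1, 0, -x₁]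
    else
      let m := (curve A B).slope x₁ x₂ y₁ y₂
      ![-m, 1, m * x₁ - y₁]

/-- The numerator of `h_{i,j}`, before the translation: `ℓ_{i,j}`, or `v_i` if `i + j = p`. -/
def hNum (p : ℕ) (P : (curve A B).Point) (i j : ℕ) : Fin 3 → K :=
  if i + j = p then vertical (i • P) else line (i • P) (j • P)

/-- The denominator of `h_{i,j}`, before the translation: `v_{i+j}`, or `1` (as a form, `Z`) if
`i + j = p`. -/
def hDen (p : ℕ) (P : (curve A B).Point) (i j : ℕ) : Fin 3 → K :=
  if i + j = p then ![0, 0, 1] else vertical ((i + j) • P)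

/-- Translation by `-T` on the canonical lift. -/
noncomputable def translate (T : (curve A B).Point) (Q : PointClass K[ε]) : PointClass K[ε] :=
  dualAdd A B Q (liftPt (-T))

/-- The value at a point `Q` of `Ẽ(K[ε])` of the function `h_{i,j}`, which is `(ℓ_{i,j} / v_{i+j}) ∘ τ`
if `i + j ≠ p` and `v_i ∘ τ` if `i + j = p`, where `τ` is the translation by `-T`. -/
noncomputable def hVal (p : ℕ) (T P : (curve A B).Point) (i j : ℕ) (Q : PointClass K[ε]) : K[ε] :=
  ratio (hNum p P i j) (hDen p P i j) (translate T Q)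

/-- The function `h_{i,j}` is defined at `Q`: the translate of `Q` is an affine point of `Ẽ(K[ε])`
and the denominator of `h_{i,j}` is invertible there. -/
def HDefined (p : ℕ) (T P : (curve A B).Point) (i j : ℕ) (Q : PointClass K[ε]) : Prop :=
  translate T Q ∈ dualPoints A B ∧ (∃ x y : K[ε], translate T Q = ⟦![x, y, 1]⟧) ∧
    RatioDefined (hDen p P i j) (translate T Q)

end Field

/-! ### Addition chains -/

/-- `S` is an addition chain for `n`: a set of integers in `{1, …, n}` that contains `n` and in which
every `k > 1` is a sum of two members. -/
def IsAdditionChain (n : ℕ) (S : Finset ℕ) : Prop :=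
  S ⊆ Finset.Icc 1 n ∧ n ∈ S ∧ ∀ k ∈ S, 1 < k → ∃ i ∈ S, ∃ j ∈ S, i + j = k

/-- `Decomposes S M C`: the steps `(i + j ↦ i, j)` with `(i, j)` in the list `C`, and
`i, j, i + j ∈ S`, applied one after the other, turn the multiset `M` into a multiset of ones. -/
inductive Decomposes (S : Finset ℕ) : Multiset ℕ → List (ℕ × ℕ) → Prop
  | ones (m : ℕ) : Decomposes S (Multiset.replicate m 1) []
  | step {i j : ℕ} {M : Multiset ℕ} {C : List (ℕ × ℕ)} (hi : i ∈ S) (hj : j ∈ S)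
      (hij : i + j ∈ S) (h : Decomposes S (i ::ₘ j ::ₘ M) C) :
      Decomposes S ((i + j) ::ₘ M) ((i, j) :: C)

/-- `C` is an addition chain decomposition of `n`: for some addition chain for `n`, its steps
decompose `n` into a sum of `n` ones. -/
def IsChainDecomposition (n : ℕ) (C : List (ℕ × ℕ)) : Prop :=
  ∃ S, IsAdditionChain n S ∧ Decomposes S {n} C

section Field

variable {K : Type*} [Field K] [DecidableEq K] {A B : K}

/-! ### The map `e` -/

open Classical in
/-- The map `e`, computed with the evaluation point `R`, the point `T` of order two and the
addition chain decomposition `C`: the product over `C` of `h_{i,j}(Q + R) / h_{i,j}(R)`, and `1` if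
`P = O` or `Q = O`. -/
noncomputable def pairing (p : ℕ) (R T : (curve A B).Point) (C : List (ℕ × ℕ))
    (P : (curve A B).Point) (Q : PointClass K[ε]) : K[ε] :=
  if P = 0 ∨ Q = infPt 0 then 1
  else (C.map fun s => hVal p T P s.1 s.2 (dualAdd A B Q (liftPt R)) *
    Ring.inverse (hVal p T P s.1 s.2 (liftPt R))).prod

end Field

section Functions

variable {K : Type*} [Field K] {A B : K}

/-! ### Functions on `E`, their derivatives and divisors -/

/-- The coordinate function `x` in the function field `K(E)`. -/
noncomputable def xF (A B : K) : (curve A B).FunctionField :=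
  algebraMap (curve A B).CoordinateRing _
    (WeierstrassCurve.Affine.CoordinateRing.mk _ (Polynomial.C Polynomial.X))

/-- The coordinate function `y` in the function field `K(E)`. -/
noncomputable def yF (A B : K) : (curve A B).FunctionField :=
  algebraMap (curve A B).CoordinateRing _
    (WeierstrassCurve.Affine.CoordinateRing.mk _ Polynomial.X)

/-- The equation of the curve holds for the coordinate functions. -/
lemma yF_sq : yF A B ^ 2 = xF A B ^ 3 + algebraMap K _ A * xF A B + algebraMap K _ B := by
  have h : WeierstrassCurve.Affine.CoordinateRing.mk (curve A B) (curve A B).polynomial = 0 :=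
    AdjoinRoot.mk_self
  have h' := congrArg (algebraMap (curve A B).CoordinateRing (curve A B).FunctionField) h
  simp only [WeierstrassCurve.Affine.polynomial, map_add, map_sub, map_mul, map_pow, map_zero,
    zero_mul, add_zero] at h'
  have hA : algebraMap K (curve A B).FunctionField A = algebraMap (curve A B).CoordinateRing _
    (WeierstrassCurve.Affine.CoordinateRing.mk _ (Polynomial.C (Polynomial.C A))) := rfl
  have hB : algebraMap K (curve A B).FunctionField B = algebraMap (curve A B).CoordinateRing _
    (WeierstrassCurve.Affine.CoordinateRing.mk _ (Polynomial.C (Polynomial.C B))) := rfl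
  rw [hA, hB, xF, yF]
  linear_combination h'

lemma yF_ne_zero : yF A B ≠ 0 := by
  intro h
  have h1 : WeierstrassCurve.Affine.CoordinateRing.mk (curve A B) Polynomial.X = 0 :=
    (FaithfulSMul.algebraMap_injective (curve A B).CoordinateRing (curve A B).FunctionField)
      (by rw [map_zero]; exact h)
  have h2 := WeierstrassCurve.Affine.CoordinateRing.smul_basis_eq_zero (W' := curve A B)
    (p := 0) (q := 1) (by rw [zero_smul, zero_add, one_smul, h1])
  exact one_ne_zero h2.2

/-- There is a `K`-linear derivation of `K(E)` that maps `x` to `1`. -/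
lemma exists_derivation (h2 : (2 : K) ≠ 0) :
    ∃ δ : Derivation K (curve A B).FunctionField (curve A B).FunctionField, δ (xF A B) = 1 := by
  let F := (curve A B).FunctionField
  let a : F := algebraMap K F A
  let b : F := algebraMap K F B
  have h2F : (2 : F) ≠ 0 := by
    have := (map_ne_zero (algebraMap K F)).mpr h2
    rwa [map_ofNat] at this
  let m : F := (3 * xF A B ^ 2 + a) / (2 * yF A B)
  have hm : 2 * yF A B * m = 3 * xF A B ^ 2 + a :=
    mul_div_cancel₀ _ (mul_ne_zero h2F yF_ne_zero)
  let i : Polynomial K →+* F[ε] := Polynomial.eval₂RingHom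
    ((TrivSqZeroExt.inlHom F F).comp (algebraMap K F))
    (TrivSqZeroExt.inl (xF A B) + TrivSqZeroExt.inr 1)
  have hi : Polynomial.eval₂ i (TrivSqZeroExt.inl (yF A B) + TrivSqZeroExt.inr m)
      (curve A B).polynomial = 0 := by
    have hy := yF_sq (A := A) (B := B)
    simp only [WeierstrassCurve.Affine.polynomial, i, Polynomial.eval₂_add, Polynomial.eval₂_sub,
      Polynomial.eval₂_mul, Polynomial.eval₂_pow, Polynomial.eval₂_X, Polynomial.eval₂_C,
      Polynomial.coe_eval₂RingHom, Polynomial.eval₂_zero, Polynomial.C_0]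
    ext
    · simp [pow_succ]
      linear_combination hy
    · simp [pow_succ]
      linear_combination hm
  let φ : (curve A B).CoordinateRing →+* F[ε] := AdjoinRoot.lift i _ hi
  have hφ : (TrivSqZeroExt.fstHom F F F : F[ε] →+* F).comp φ = algebraMap _ F := by
    refine AdjoinRoot.ringHom_ext (Polynomial.ringHom_ext (fun c => ?_) ?_) ?_
    · simp [φ, i]
      rfl
    · simp [φ, i]
      rfl
    · simp [φ]
      rfl
  have hφ' (r) : (φ r).fst = algebraMap _ F r := congrArg (fun f => f r) hφ
  let ψ : F →+* F[ε] := IsLocalization.lift (M := nonZeroDivisors (curve A B).CoordinateRing)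
    (g := φ) (fun r => by
      rw [TrivSqZeroExt.isUnit_iff_isUnit_fst, hφ']
      exact IsLocalization.map_units F r)
  have hψφ (r) : ψ (algebraMap _ F r) = φ r := IsLocalization.lift_eq _ r
  have hψ (f : F) : (ψ f).fst = f := by
    have : (TrivSqZeroExt.fstHom F F F : F[ε] →+* F).comp ψ = RingHom.id F :=
      IsLocalization.ringHom_ext (nonZeroDivisors (curve A B).CoordinateRing) (by
        refine RingHom.ext fun r => ?_
        change (ψ (algebraMap _ F r)).fst = algebraMap _ F r
        rw [hψφ, hφ'])
    exact congrArg (fun g => g f) this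
  have hψK (c : K) : ψ (algebraMap K F c) = TrivSqZeroExt.inl (algebraMap K F c) := by
    have : algebraMap K F c = algebraMap (curve A B).CoordinateRing F
      (AdjoinRoot.of _ (Polynomial.C c)) := rfl
    rw [this, hψφ, ← this]
    simp [φ, i]
  refine ⟨Derivation.mk' ⟨⟨fun f => (ψ f).snd, ?_⟩, ?_⟩ ?_, ?_⟩
  · intro f g
    simp
  · intro c f
    change (ψ (c • f)).snd = c • (ψ f).snd
    rw [Algebra.smul_def, map_mul, hψK, Algebra.smul_def]
    simp
  · intro f g
    change (ψ (f * g)).snd = f • (ψ g).snd + g • (ψ f).snd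
    rw [map_mul, TrivSqZeroExt.snd_mul, hψ, hψ]
    simp [mul_comm]
  · change (ψ (xF A B)).snd = 1
    rw [xF, hψφ]
    simp [φ, i]

/-- There is only one such derivation. -/
lemma derivation_unique (h2 : (2 : K) ≠ 0)
    {δ₁ δ₂ : Derivation K (curve A B).FunctionField (curve A B).FunctionField}
    (h₁ : δ₁ (xF A B) = 1) (h₂ : δ₂ (xF A B) = 1) : δ₁ = δ₂ := by
  let F := (curve A B).FunctionField
  have h2F : (2 : F) ≠ 0 := by
    have := (map_ne_zero (algebraMap K F)).mpr h2
    rwa [map_ofNat] at this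
  suffices h : ∀ δ : Derivation K (curve A B).FunctionField (curve A B).FunctionField,
      δ (xF A B) = 0 → δ = 0 from
    sub_eq_zero.mp (h (δ₁ - δ₂) (by simp [h₁, h₂]))
  intro δ hx
  have hy : δ (yF A B) = 0 := by
    have h := congrArg δ (yF_sq (A := A) (B := B))
    simp only [map_add, Derivation.leibniz_pow, Derivation.leibniz, Derivation.map_algebraMap, hx,
      add_zero, nsmul_eq_mul, smul_eq_mul] at h
    simpa [h2F, yF_ne_zero] using h
  have hX (q : Polynomial K) : δ (algebraMap (curve A B).CoordinateRing F
      (AdjoinRoot.of (curve A B).polynomial q)) = 0 := by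
    induction q using Polynomial.induction_on' with
    | add q r hq hr => simp [hq, hr]
    | monomial n c =>
      have : algebraMap (curve A B).CoordinateRing F (AdjoinRoot.of (curve A B).polynomial
          (Polynomial.monomial n c)) = c • xF A B ^ n := by
        rw [← Polynomial.C_mul_X_pow_eq_monomial, map_mul, map_mul, map_pow, map_pow,
          Algebra.smul_def]
        rfl
      rw [this, Derivation.map_smul, Derivation.leibniz_pow, hx]
      simp
  have hR (r : (curve A B).CoordinateRing) : δ (algebraMap _ F r) = 0 := by
    induction r using AdjoinRoot.induction_on with
    | ih q =>
      induction q using Polynomial.induction_on' with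
      | add q r hq hr => simp [hq, hr]
      | monomial n c =>
        have : algebraMap (curve A B).CoordinateRing F (AdjoinRoot.mk (curve A B).polynomial
            (Polynomial.monomial n c)) = algebraMap (curve A B).CoordinateRing F
              (AdjoinRoot.of (curve A B).polynomial c) * yF A B ^ n := by
          rw [← Polynomial.C_mul_X_pow_eq_monomial, map_mul, map_mul, map_pow, map_pow]
          rfl
        rw [this, Derivation.leibniz, Derivation.leibniz_pow, hy, hX]
        simp
  ext f
  obtain ⟨r, s, hs, rfl⟩ := IsFractionRing.div_surjective (A := (curve A B).CoordinateRing) f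
  rw [div_eq_mul_inv, Derivation.leibniz, Derivation.leibniz_inv, hR, hR]
  simp

/-- Differentiation `d/dx` of functions on `E` (in characteristic other than two): the `K`-linear
derivation of `K(E)` that maps `x` to `1`. -/
noncomputable def ddx (A B : K) (h2 : (2 : K) ≠ 0) :
    Derivation K (curve A B).FunctionField (curve A B).FunctionField :=
  (exists_derivation h2).choose

/-- The function `g` is regular at the point `P` of `E` and has the value `c` there: it is a
quotient `N / D` of forms of the same degree in projective coordinates with `D(P) ≠ 0`, and
`N(P) / D(P) = c`. -/
def HasValueAt (g : (curve A B).FunctionField) (P : (curve A B).Point) (c : K) : Prop :=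
  ∃ (n : ℕ) (N D : MvPolynomial (Fin 3) K), N.IsHomogeneous n ∧ D.IsHomogeneous n ∧
    MvPolynomial.eval (coords P) D ≠ 0 ∧
    g * MvPolynomial.aeval ![xF A B, yF A B, 1] D = MvPolynomial.aeval ![xF A B, yF A B, 1] N ∧
    MvPolynomial.eval (coords P) N / MvPolynomial.eval (coords P) D = c

/-- `t` is a uniformizer at `P`: it generates the ideal of the functions that vanish at `P` in the
ring of the functions that are regular at `P`. -/
def IsUniformizerAt (t : (curve A B).FunctionField) (P : (curve A B).Point) : Prop :=
  HasValueAt t P 0 ∧ ∀ g, HasValueAt g P 0 → ∃ u c, HasValueAt u P c ∧ g = t * u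

/-- The function `f` is nonzero and has order `n` at `P`: it is `t ^ n * u` for a uniformizer `t`
and a function `u` that is regular and does not vanish at `P`. -/
def HasOrderAt (f : (curve A B).FunctionField) (P : (curve A B).Point) (n : ℤ) : Prop :=
  ∃ t u c, IsUniformizerAt t P ∧ HasValueAt u P c ∧ c ≠ 0 ∧ f = t ^ n * u

/-- The divisor of the function `f` is `D`. -/
def HasDivisor (f : (curve A B).FunctionField) (D : (curve A B).Point →₀ ℤ) : Prop :=
  ∀ P, HasOrderAt f P (D P)

end Functions

end DualPairing

open DualPairing

/- Let `D = 2 y d/dx` be the invariant derivation of `K(E)`. At every point of `E` it preserves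
regularity, so `D g / g` has at most a simple pole at each point, with residue the order of `g`
there. If `g` has the divisor `p D_P`, all residues vanish in `K`; then `D g / g` is regular
everywhere, hence a constant `c`, and `c` depends only on `P`: two functions with the divisors
`p D_P` and `p D_P'`, where `D_P` and `D_P'` are equivalent, differ by a constant times a `p`-th
power, and `p`-th powers are killed by `D`. Adding points adds the divisors, up to equivalence, so
`P ↦ c` is additive.

On the other side, `O_k + W` is the point `W` moved by the tangent vector `-k ε D`, since addition
of a point of `Θ` commutes with translations. Hence
`h (O_k + W) = h (W) (1 - (D h / h)(W) k ε)` for every function `h` that is regular and nonzero at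
`W`. The product of the untranslated `h_{i,j}` over an addition chain decomposition telescopes to a
function with the divisor `p (P) - p (O)`, so `e (P, O_k) = 1 - c k ε`. All factors are units
because `W = R - T` is not a `p`-torsion point, whereas the zeros and poles of the `h_{i,j}` are. -/

namespace DualPairing

open MvPolynomial (aeval eval)
open WeierstrassCurve.Affine (CoordinateRing Point)

section Forms

variable {σ R S : Type*} [CommSemiring R] [CommSemiring S] [Algebra R S]

lemma aeval_smul_of_isHomogeneous {N : MvPolynomial σ R} {n : ℕ} (hN : N.IsHomogeneous n) (u : S)
    (q : σ → S) : aeval (u • q) N = u ^ n * aeval q N := by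
  simp only [MvPolynomial.aeval_def, MvPolynomial.eval₂_eq, Finset.mul_sum]
  refine Finset.sum_congr rfl fun d hd => ?_
  simp only [Pi.smul_apply, smul_eq_mul, mul_pow, Finset.prod_mul_distrib,
    Finset.prod_pow_eq_pow_sum, ← hN.degree_eq_sum_deg_support hd]
  ring

/-- The homogenization of degree `n` of the polynomial `N`, with respect to the variable `X j`. The
components of `N` of degree greater than `n` are dropped. -/
noncomputable def homogenize (j : σ) (n : ℕ) (N : MvPolynomial σ R) : MvPolynomial σ R :=
  ∑ i ∈ Finset.range (n + 1), N.homogeneousComponent i * MvPolynomial.X j ^ (n - i)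

lemma isHomogeneous_homogenize (j : σ) (n : ℕ) (N : MvPolynomial σ R) :
    (homogenize j n N).IsHomogeneous n := by
  refine MvPolynomial.IsHomogeneous.sum _ _ _ fun i hi => ?_
  have hin : i + (n - i) = n := Nat.add_sub_of_le (Finset.mem_range_succ_iff.mp hi)
  simpa only [hin] using (MvPolynomial.homogeneousComponent_isHomogeneous i N).mul
    (MvPolynomial.isHomogeneous_X_pow j (n - i))

lemma aeval_homogenize {j : σ} {n : ℕ} {N : MvPolynomial σ R} (hn : N.totalDegree ≤ n)
    {q : σ → S} (hq : q j = 1) : aeval q (homogenize j n N) = aeval q N := by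
  conv_rhs => rw [← MvPolynomial.sum_homogeneousComponent N]
  simp only [homogenize, map_sum, map_mul, map_pow, MvPolynomial.aeval_X, hq, one_pow, mul_one]
  refine (Finset.sum_subset (Finset.range_mono (by lia)) fun i _ hi => ?_).symm
  rw [MvPolynomial.homogeneousComponent_eq_zero _ _ (by simpa using hi), map_zero]

end Forms

section PoleOrder

open scoped Polynomial

variable {K : Type*} [Field K] {A B : K}

/-- The coordinates `x, y, 1` in the affine coordinate ring. -/
noncomputable def ringCoords (A B : K) : Fin 3 → (curve A B).CoordinateRing :=
  ![CoordinateRing.mk _ (Polynomial.C Polynomial.X), CoordinateRing.mk _ Polynomial.X, 1]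

/-- The order of the pole at infinity of a function in the affine coordinate ring, computed as the
degree of its norm to `K[x]`; it is `⊥` for the function `0`. -/
noncomputable def poleOrder (r : (curve A B).CoordinateRing) : WithBot ℕ :=
  (Algebra.norm K[X] r).degree

lemma poleOrder_mul (r s : (curve A B).CoordinateRing) :
    poleOrder (r * s) = poleOrder r + poleOrder s := by
  rw [poleOrder, map_mul, Polynomial.degree_mul, poleOrder, poleOrder]

lemma poleOrder_pow (r : (curve A B).CoordinateRing) (n : ℕ) :
    poleOrder (r ^ n) = n • poleOrder r := by
  rw [poleOrder, map_pow, Polynomial.degree_pow, poleOrder]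

lemma poleOrder_smul_basis (p q : K[X]) :
    poleOrder (p • 1 + q • CoordinateRing.mk (curve A B) Polynomial.X) =
      max (2 • p.degree) (2 • q.degree + 3) :=
  CoordinateRing.degree_norm_smul_basis p q

lemma poleOrder_add_le (r s : (curve A B).CoordinateRing) :
    poleOrder (r + s) ≤ max (poleOrder r) (poleOrder s) := by
  obtain ⟨p, q, rfl⟩ := CoordinateRing.exists_smul_basis_eq r
  obtain ⟨p', q', rfl⟩ := CoordinateRing.exists_smul_basis_eq s
  have hadd (f g : K[X]) : 2 • (f + g).degree ≤ max (2 • f.degree) (2 • g.degree) := by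
    rcases le_max_iff.mp (Polynomial.degree_add_le f g) with h | h
    · exact le_max_of_le_left (nsmul_le_nsmul_right h 2)
    · exact le_max_of_le_right (nsmul_le_nsmul_right h 2)
  rw [add_add_add_comm, ← add_smul, ← add_smul]
  simp only [poleOrder_smul_basis]
  refine max_le ((hadd p p').trans (by gcongr <;> exact le_max_left _ _)) ?_
  calc 2 • (q + q').degree + 3
      ≤ max (2 • q.degree) (2 • q'.degree) + 3 := by gcongr; exact hadd q q'
    _ = max (2 • q.degree + 3) (2 • q'.degree + 3) := max_add _ _ _
    _ ≤ _ := by gcongr <;> exact le_max_right _ _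

lemma poleOrder_polynomial_smul_one (p : K[X]) :
    poleOrder (p • (1 : (curve A B).CoordinateRing)) = 2 • p.degree := by
  simpa using poleOrder_smul_basis (A := A) (B := B) p 0

lemma poleOrder_smul {c : K} (hc : c ≠ 0) (r : (curve A B).CoordinateRing) :
    poleOrder (c • r) = poleOrder r := by
  have h : c • r = (Polynomial.C c • 1) * r := by
    rw [smul_mul_assoc, one_mul, ← Polynomial.algebraMap_eq, algebraMap_smul]
  rw [h, poleOrder_mul, poleOrder_polynomial_smul_one, Polynomial.degree_C hc, smul_zero, zero_add]

lemma poleOrder_zero : poleOrder (0 : (curve A B).CoordinateRing) = ⊥ := by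
  simpa using poleOrder_polynomial_smul_one (A := A) (B := B) 0

lemma poleOrder_ringCoords (i : Fin 3) :
    poleOrder (ringCoords A B i) = (![2, 3, 0] i : ℕ) := by
  have hx := poleOrder_polynomial_smul_one (A := A) (B := B) Polynomial.X
  have hy := poleOrder_smul_basis (A := A) (B := B) 0 1
  have h1 := poleOrder_polynomial_smul_one (A := A) (B := B) 1
  rw [CoordinateRing.smul, mul_one] at hx
  fin_cases i
  · simpa using! hx
  · simpa using! hy
  · simpa using! h1

/-- The functions in the affine coordinate ring whose pole at infinity has order less than `n`. -/
noncomputable def poleOrderLT (A B : K) (n : ℕ) : Submodule K (curve A B).CoordinateRing where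
  carrier := {r | poleOrder r < n}
  zero_mem' := poleOrder_zero.trans_lt (WithBot.bot_lt_coe n)
  add_mem' hr hs := (poleOrder_add_le _ _).trans_lt (max_lt hr hs)
  smul_mem' c r hr := by
    rcases eq_or_ne c 0 with rfl | hc
    · exact (zero_smul K r).symm ▸ poleOrder_zero.trans_lt (WithBot.bot_lt_coe n)
    · exact (poleOrder_smul hc r).trans_lt hr

lemma mem_poleOrderLT {r : (curve A B).CoordinateRing} {n : ℕ} :
    r ∈ poleOrderLT A B n ↔ poleOrder r < n :=
  Iff.rfl

lemma poleOrder_y_pow (n : ℕ) : poleOrder (ringCoords A B 1 ^ n) = (3 * n : ℕ) := by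
  rw [poleOrder_pow, poleOrder_ringCoords, mul_comm]
  simp

/- A monomial other than `Y ^ n` vanishes at `(0 : 1 : 0)`, and its pole has order `< 3 n` because
`x` and `1` have poles of order `2` and `0`, against `3` for `y`. -/
lemma prod_ringCoords_sub_mem_poleOrderLT (d : Fin 3 →₀ ℕ) :
    ∏ i, ringCoords A B i ^ d i - (∏ i, (![0, 1, 0] : Fin 3 → K) i ^ d i) •
      ringCoords A B 1 ^ (∑ i, d i) ∈ poleOrderLT A B (3 * ∑ i, d i) := by
  simp only [Fin.prod_univ_three, Fin.sum_univ_three]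
  by_cases hd : d 0 = 0 ∧ d 2 = 0
  · simp [hd]
  · have hzero : (0 : K) ^ d 0 * 1 ^ d 1 * 0 ^ d 2 = 0 := by
      rw [one_pow, mul_one, mul_eq_zero, pow_eq_zero_iff', pow_eq_zero_iff']
      tauto
    have hlt : d 0 * 2 + d 1 * 3 + d 2 * 0 < 3 * (d 0 + d 1 + d 2) := by lia
    simp only [Matrix.cons_val, hzero, zero_smul, sub_zero, mem_poleOrderLT, poleOrder_mul,
      poleOrder_pow, poleOrder_ringCoords, nsmul_eq_mul]
    exact_mod_cast hlt

variable {N : MvPolynomial (Fin 3) K} {n : ℕ}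

lemma aeval_ringCoords_sub_mem_poleOrderLT (hN : N.IsHomogeneous n) :
    aeval (ringCoords A B) N - eval ![0, 1, 0] N • ringCoords A B 1 ^ n ∈
      poleOrderLT A B (3 * n) := by
  rw [MvPolynomial.aeval_def, MvPolynomial.eval₂_eq', MvPolynomial.eval_eq', Finset.sum_smul,
    ← Finset.sum_sub_distrib]
  refine Submodule.sum_mem _ fun d hd => ?_
  have hdeg : ∑ i, d i = n := by
    rw [← Finsupp.degree_eq_sum]
    exact (hN.degree_eq_sum_deg_support hd).symm
  rw [← Algebra.smul_def, mul_smul, ← smul_sub, ← hdeg]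
  exact Submodule.smul_mem _ _ (prod_ringCoords_sub_mem_poleOrderLT d)

lemma poleOrder_aeval_ringCoords_le (hN : N.IsHomogeneous n) :
    poleOrder (aeval (ringCoords A B) N) ≤ (3 * n : ℕ) := by
  rw [← sub_add_cancel (aeval (ringCoords A B) N) (eval ![0, 1, 0] N • ringCoords A B 1 ^ n)]
  refine (poleOrder_add_le _ _).trans (max_le (aeval_ringCoords_sub_mem_poleOrderLT hN).le ?_)
  rcases eq_or_ne (eval ![0, 1, 0] N) 0 with h | h
  · rw [h, zero_smul, poleOrder_zero]
    exact bot_le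
  · rw [poleOrder_smul h, poleOrder_y_pow]

lemma poleOrder_aeval_ringCoords (hN : N.IsHomogeneous n) (h : eval ![0, 1, 0] N ≠ 0) :
    poleOrder (aeval (ringCoords A B) N) = (3 * n : ℕ) := by
  refine (poleOrder_aeval_ringCoords_le hN).antisymm (not_lt.mp fun hlt => ?_)
  have hy := Submodule.sub_mem _ (mem_poleOrderLT.mpr hlt)
    (aeval_ringCoords_sub_mem_poleOrderLT (A := A) (B := B) hN)
  rw [sub_sub_cancel, mem_poleOrderLT, poleOrder_smul h, poleOrder_y_pow] at hy
  exact hy.false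

lemma exists_eq_algebraMap_of_poleOrder_le_zero {r : (curve A B).CoordinateRing}
    (hr : poleOrder r ≤ 0) : ∃ c : K, r = algebraMap K _ c := by
  obtain ⟨p, q, rfl⟩ := CoordinateRing.exists_smul_basis_eq r
  rw [poleOrder_smul_basis, max_le_iff] at hr
  have hq : q = 0 := by
    by_contra hq
    rw [Polynomial.degree_eq_natDegree hq, nsmul_eq_mul, nsmul_eq_mul] at hr
    have : 2 * q.natDegree + 3 ≤ 0 := by exact_mod_cast hr.2
    lia
  have hp : p.degree ≤ 0 := by
    rcases eq_or_ne p 0 with rfl | hp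
    · simp
    rw [Polynomial.degree_eq_natDegree hp, nsmul_eq_mul] at hr
    rw [Polynomial.degree_eq_natDegree hp]
    have : 2 * p.natDegree ≤ 0 := by exact_mod_cast hr.1
    exact_mod_cast show p.natDegree ≤ 0 by lia
  refine ⟨p.coeff 0, ?_⟩
  rw [hq, zero_smul, add_zero, Polynomial.eq_C_of_degree_le_zero hp, Polynomial.coeff_C_zero,
    ← Polynomial.algebraMap_eq, algebraMap_smul, Algebra.algebraMap_eq_smul_one]

end PoleOrder

section Values

variable {K : Type*} [Field K] {A B : K}

lemma algebraMap_aeval_ringCoords (N : MvPolynomial (Fin 3) K) :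
    algebraMap _ (curve A B).FunctionField (aeval (ringCoords A B) N) =
      aeval ![xF A B, yF A B, 1] N := by
  rw [← MvPolynomial.aeval_algebraMap_apply]
  congr 2
  ext i
  fin_cases i <;> simp [ringCoords, xF, yF]

/-- Evaluation of the affine coordinate ring at an affine point of the curve. -/
noncomputable def evalAlgHom {x y : K} (h : (curve A B).Equation x y) :
    (curve A B).CoordinateRing →ₐ[K] K :=
  { AdjoinRoot.evalEval h with
    commutes' := fun c => by
      change AdjoinRoot.evalEval h (AdjoinRoot.of _ (Polynomial.C c)) = c
      simp [AdjoinRoot.evalEval] }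

lemma evalAlgHom_ringCoords {x y : K} (h : (curve A B).Equation x y) (i : Fin 3) :
    evalAlgHom h (ringCoords A B i) = ![x, y, 1] i := by
  change AdjoinRoot.evalEval h (ringCoords A B i) = _
  fin_cases i <;> simp [ringCoords, AdjoinRoot.evalEval]

lemma aeval_apply_algHom_ringCoords (φ : (curve A B).CoordinateRing →ₐ[K] K)
    (N : MvPolynomial (Fin 3) K) :
    φ (aeval (ringCoords A B) N) = eval (fun i => φ (ringCoords A B i)) N := by
  rw [← MvPolynomial.aeval_eq_eval, MvPolynomial.comp_aeval_apply]

/-- Projective coordinates on `E` one of which is `1`, as functions that are regular at the given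
point. -/
noncomputable def chart : (curve A B).Point → Fin 3 → (curve A B).FunctionField
  | .zero => ![xF A B / yF A B, 1, 1 / yF A B]
  | .some _ _ _ => ![xF A B, yF A B, 1]

lemma exists_chart_coord_eq_one (P : (curve A B).Point) :
    ∃ j, chart P j = 1 ∧ coords P j = 1 := by
  match P with
  | .zero => exact ⟨1, rfl, rfl⟩
  | .some _ _ _ => exact ⟨2, rfl, rfl⟩

lemma exists_smul_chart (P : (curve A B).Point) :
    ∃ u : (curve A B).FunctionField, u ≠ 0 ∧ ![xF A B, yF A B, 1] = u • chart P := by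
  match P with
  | .zero =>
    have hy := yF_ne_zero (A := A) (B := B)
    refine ⟨yF A B, hy, ?_⟩
    ext i
    fin_cases i <;> simp [chart, mul_div_cancel₀, hy]
  | .some _ _ _ => exact ⟨1, one_ne_zero, by simp [chart]⟩

lemma eval_coords_eq_zero_of_aeval_ringCoords {N : MvPolynomial (Fin 3) K} {n : ℕ}
    (hN : N.IsHomogeneous n) (h0 : aeval (ringCoords A B) N = 0) (P : (curve A B).Point) :
    eval (coords P) N = 0 := by
  match P with
  | .zero =>
    by_contra h
    have hdeg := poleOrder_aeval_ringCoords (A := A) (B := B) hN h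
    rw [h0, poleOrder_zero] at hdeg
    exact WithBot.bot_ne_coe hdeg
  | .some x y h =>
    have hev := aeval_apply_algHom_ringCoords (evalAlgHom h.1) N
    rw [h0, map_zero, funext (evalAlgHom_ringCoords h.1)] at hev
    exact hev.symm

lemma eval_coords_eq_zero_of_aeval_chart {P : (curve A B).Point} {N : MvPolynomial (Fin 3) K}
    (hN : aeval (chart P) N = 0) : eval (coords P) N = 0 := by
  obtain ⟨j, hj, hj'⟩ := exists_chart_coord_eq_one P
  obtain ⟨u, -, hu⟩ := exists_smul_chart P
  have hhom := isHomogeneous_homogenize j N.totalDegree N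
  have h0 : aeval (ringCoords A B) (homogenize j N.totalDegree N) = 0 := by
    apply FaithfulSMul.algebraMap_injective _ (curve A B).FunctionField
    rw [algebraMap_aeval_ringCoords, hu, aeval_smul_of_isHomogeneous hhom,
      aeval_homogenize le_rfl hj, hN, mul_zero, map_zero]
  have hP := eval_coords_eq_zero_of_aeval_ringCoords hhom h0 P
  rwa [← MvPolynomial.aeval_eq_eval, aeval_homogenize le_rfl hj'] at hP

lemma aeval_chart_ne_zero {P : (curve A B).Point} {N : MvPolynomial (Fin 3) K}
    (hN : eval (coords P) N ≠ 0) : aeval (chart P) N ≠ 0 :=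
  mt eval_coords_eq_zero_of_aeval_chart hN

lemma hasValueAt_iff {g : (curve A B).FunctionField} {P : (curve A B).Point} {c : K} :
    HasValueAt g P c ↔ ∃ N D : MvPolynomial (Fin 3) K, eval (coords P) D ≠ 0 ∧
      g * aeval (chart P) D = aeval (chart P) N ∧
      eval (coords P) N = c * eval (coords P) D := by
  obtain ⟨u, hu0, hu⟩ := exists_smul_chart P
  constructor
  · rintro ⟨n, N, D, hN, hD, hD0, hg, hc⟩
    refine ⟨N, D, hD0, ?_, by rw [← hc, div_mul_cancel₀ _ hD0]⟩
    rw [hu, aeval_smul_of_isHomogeneous hN, aeval_smul_of_isHomogeneous hD] at hg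
    refine mul_left_cancel₀ (pow_ne_zero n hu0) ?_
    linear_combination hg
  · rintro ⟨N, D, hD0, hg, hc⟩
    obtain ⟨j, hj, hj'⟩ := exists_chart_coord_eq_one P
    let n := max N.totalDegree D.totalDegree
    have hN := isHomogeneous_homogenize j n N
    have hD := isHomogeneous_homogenize j n D
    have hNn : N.totalDegree ≤ n := le_max_left _ _
    have hDn : D.totalDegree ≤ n := le_max_right _ _
    have hNP := aeval_homogenize hNn hj'
    have hDP := aeval_homogenize hDn hj'
    rw [MvPolynomial.aeval_eq_eval] at hNP hDP
    refine ⟨n, _, _, hN, hD, hDP ▸ hD0, ?_, ?_⟩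
    · rw [hu, aeval_smul_of_isHomogeneous hN, aeval_smul_of_isHomogeneous hD,
        aeval_homogenize hNn hj, aeval_homogenize hDn hj, ← hg]
      ring
    · exact (congrArg₂ (· / ·) hNP hDP).trans ((div_eq_iff hD0).mpr hc)

namespace HasValueAt

variable {g h : (curve A B).FunctionField} {P : (curve A B).Point} {c d : K}

lemma aeval_chart (P : (curve A B).Point) (N : MvPolynomial (Fin 3) K) :
    HasValueAt (aeval (chart P) N) P (eval (coords P) N) :=
  hasValueAt_iff.mpr ⟨N, 1, by simp, by simp, by simp⟩

lemma const (P : (curve A B).Point) (c : K) :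
    HasValueAt (algebraMap K (curve A B).FunctionField c) P c := by
  simpa using aeval_chart P (MvPolynomial.C c)

lemma zero (P : (curve A B).Point) : HasValueAt 0 P 0 := by
  simpa using const P 0

lemma one (P : (curve A B).Point) : HasValueAt 1 P 1 := by
  simpa using const P 1

lemma add (hg : HasValueAt g P c) (hh : HasValueAt h P d) : HasValueAt (g + h) P (c + d) := by
  obtain ⟨N, D, hD, h1, h2⟩ := hasValueAt_iff.mp hg
  obtain ⟨N', D', hD', h1', h2'⟩ := hasValueAt_iff.mp hh
  refine hasValueAt_iff.mpr ⟨N * D' + N' * D, D * D', by simp [hD, hD'], ?_, ?_⟩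
  · simp only [map_mul, map_add]
    linear_combination aeval (chart P) D' * h1 + aeval (chart P) D * h1'
  · simp only [map_mul, map_add, h2, h2']
    ring

lemma mul (hg : HasValueAt g P c) (hh : HasValueAt h P d) : HasValueAt (g * h) P (c * d) := by
  obtain ⟨N, D, hD, h1, h2⟩ := hasValueAt_iff.mp hg
  obtain ⟨N', D', hD', h1', h2'⟩ := hasValueAt_iff.mp hh
  refine hasValueAt_iff.mpr ⟨N * N', D * D', by simp [hD, hD'], ?_, ?_⟩
  · simp only [map_mul, ← h1, ← h1']
    ring
  · simp only [map_mul, h2, h2']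
    ring

lemma neg (hg : HasValueAt g P c) : HasValueAt (-g) P (-c) := by
  simpa using (const P (-1)).mul hg

lemma sub (hg : HasValueAt g P c) (hh : HasValueAt h P d) : HasValueAt (g - h) P (c - d) := by
  simpa [sub_eq_add_neg] using hg.add hh.neg

lemma pow (hg : HasValueAt g P c) (n : ℕ) : HasValueAt (g ^ n) P (c ^ n) := by
  induction n with
  | zero => simpa using one P
  | succ n ih => simpa only [pow_succ] using ih.mul hg

lemma unique (hg : HasValueAt g P c) (hg' : HasValueAt g P d) : c = d := by
  obtain ⟨N, D, hD, h1, h2⟩ := hasValueAt_iff.mp hg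
  obtain ⟨N', D', hD', h1', h2'⟩ := hasValueAt_iff.mp hg'
  have h : aeval (chart P) (N * D' - N' * D) = 0 := by
    simp only [map_mul, map_sub, ← h1, ← h1']
    ring
  have hP := eval_coords_eq_zero_of_aeval_chart h
  simp only [map_mul, map_sub, h2, h2'] at hP
  have hcd : (c - d) * (eval (coords P) D * eval (coords P) D') = 0 := by
    linear_combination hP
  simpa [hD, hD', sub_eq_zero] using hcd

lemma ne_zero (hg : HasValueAt g P c) (hc : c ≠ 0) : g ≠ 0 := by
  rintro rfl
  exact hc (hg.unique (zero P))

lemma inv (hg : HasValueAt g P c) (hc : c ≠ 0) : HasValueAt g⁻¹ P c⁻¹ := by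
  have h0 := hg.ne_zero hc
  obtain ⟨N, D, hD, h1, h2⟩ := hasValueAt_iff.mp hg
  refine hasValueAt_iff.mpr ⟨D, N, by simp [h2, hc, hD], by rw [← h1, inv_mul_cancel_left₀ h0], ?_⟩
  rw [h2, inv_mul_cancel_left₀ hc]

lemma div (hg : HasValueAt g P c) (hh : HasValueAt h P d) (hd : d ≠ 0) :
    HasValueAt (g / h) P (c / d) := by
  simpa only [div_eq_mul_inv] using hg.mul (hh.inv hd)

lemma zpow (hg : HasValueAt g P c) (hc : c ≠ 0) (n : ℤ) : HasValueAt (g ^ n) P (c ^ n) := by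
  cases n with
  | ofNat n => simpa using hg.pow n
  | negSucc n => simpa only [zpow_negSucc] using (hg.pow (n + 1)).inv (pow_ne_zero _ hc)

lemma chart_apply (P : (curve A B).Point) (i : Fin 3) : HasValueAt (chart P i) P (coords P i) := by
  simpa using aeval_chart P (MvPolynomial.X i)

end HasValueAt

lemma ddx_xF (h2 : (2 : K) ≠ 0) : ddx A B h2 (xF A B) = 1 :=
  (exists_derivation h2).choose_spec

lemma two_ne_zero_functionField (h2 : (2 : K) ≠ 0) : (2 : (curve A B).FunctionField) ≠ 0 := by
  have := (map_ne_zero (algebraMap K (curve A B).FunctionField)).mpr h2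
  rwa [map_ofNat] at this

/-- The derivation `2 y d/dx`, which is invariant under translations. -/
noncomputable def invDer (A B : K) (h2 : (2 : K) ≠ 0) :
    Derivation K (curve A B).FunctionField (curve A B).FunctionField :=
  (2 * yF A B) • ddx A B h2

lemma invDer_apply (h2 : (2 : K) ≠ 0) (g : (curve A B).FunctionField) :
    invDer A B h2 g = 2 * yF A B * ddx A B h2 g := rfl

lemma invDer_xF (h2 : (2 : K) ≠ 0) : invDer A B h2 (xF A B) = 2 * yF A B := by
  rw [invDer_apply, ddx_xF, mul_one]

lemma invDer_yF (h2 : (2 : K) ≠ 0) :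
    invDer A B h2 (yF A B) = 3 * xF A B ^ 2 + algebraMap K _ A := by
  have h := congrArg (invDer A B h2) (yF_sq (A := A) (B := B))
  simp only [map_add, Derivation.leibniz_pow, Derivation.leibniz, Derivation.map_algebraMap,
    invDer_xF, nsmul_eq_mul, smul_eq_mul, Nat.cast_ofNat, pow_one, Nat.add_one_sub_one] at h
  refine mul_left_cancel₀ (mul_ne_zero (two_ne_zero_functionField h2) yF_ne_zero) ?_
  linear_combination h

lemma exists_invDer_chart (h2 : (2 : K) ≠ 0) (P : (curve A B).Point) (i : Fin 3) :
    ∃ M : MvPolynomial (Fin 3) K, invDer A B h2 (chart P i) = aeval (chart P) M := by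
  match P with
  | .zero =>
    have hy := yF_ne_zero (A := A) (B := B)
    have he := yF_sq (A := A) (B := B)
    fin_cases i
    · refine ⟨-1 + 2 * MvPolynomial.C A * MvPolynomial.X 0 * MvPolynomial.X 2 +
        3 * MvPolynomial.C B * MvPolynomial.X 2 ^ 2, ?_⟩
      simp [chart, div_eq_mul_inv, Derivation.leibniz_inv, invDer_xF, invDer_yF]
      field_simp
      linear_combination 3 * he
    · exact ⟨0, by simp [chart]⟩
    · refine ⟨- (3 * MvPolynomial.X 0 ^ 2 + MvPolynomial.C A * MvPolynomial.X 2 ^ 2), ?_⟩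
      simp [chart, Derivation.leibniz_inv, invDer_yF]
      field_simp
      ring
  | .some x y h =>
    fin_cases i
    · exact ⟨2 * MvPolynomial.X 1, by simp [chart, invDer_xF]⟩
    · exact ⟨3 * MvPolynomial.X 0 ^ 2 + MvPolynomial.C A, by simp [chart, invDer_yF]⟩
    · exact ⟨0, by simp [chart]⟩

lemma exists_invDer_aeval_chart (h2 : (2 : K) ≠ 0) (P : (curve A B).Point)
    (N : MvPolynomial (Fin 3) K) : ∃ M : MvPolynomial (Fin 3) K,
      invDer A B h2 (aeval (chart P) N) = aeval (chart P) M := by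
  induction N using MvPolynomial.induction_on with
  | C c => exact ⟨0, by simp⟩
  | add p q hp hq =>
    obtain ⟨M, hM⟩ := hp
    obtain ⟨M', hM'⟩ := hq
    exact ⟨M + M', by simp [hM, hM']⟩
  | mul_X p i hp =>
    obtain ⟨M, hM⟩ := hp
    obtain ⟨M', hM'⟩ := exists_invDer_chart h2 P i
    exact ⟨p * M' + MvPolynomial.X i * M, by simp [hM, hM']⟩

lemma HasValueAt.exists_invDer (h2 : (2 : K) ≠ 0) {g : (curve A B).FunctionField}
    {P : (curve A B).Point} {c : K} (hg : HasValueAt g P c) :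
    ∃ d, HasValueAt (invDer A B h2 g) P d := by
  obtain ⟨N, D, hD, h1, -⟩ := hasValueAt_iff.mp hg
  obtain ⟨N', hN'⟩ := exists_invDer_aeval_chart h2 P N
  obtain ⟨D', hD'⟩ := exists_invDer_aeval_chart h2 P D
  have h := congrArg (invDer A B h2) h1
  rw [Derivation.leibniz, hN', hD', smul_eq_mul, smul_eq_mul] at h
  have hquot : invDer A B h2 g =
      (aeval (chart P) N' - g * aeval (chart P) D') / aeval (chart P) D := by
    rw [eq_div_iff (aeval_chart_ne_zero hD)]
    linear_combination h
  rw [hquot]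
  exact ⟨_, ((HasValueAt.aeval_chart P N').sub (hg.mul (.aeval_chart P D'))).div
    (.aeval_chart P D) hD⟩

end Values

lemma exists_algHom_ker_eq {k R : Type*} [Field k] [IsAlgClosed k] [CommRing R] [Algebra k R]
    [Algebra.FiniteType k R] (m : Ideal R) [m.IsMaximal] :
    ∃ φ : R →ₐ[k] k, RingHom.ker φ = m := by
  let := Ideal.Quotient.field m
  have : Module.Finite k (R ⧸ m) := finite_of_finite_type_of_isJacobsonRing k _
  let e := AlgEquiv.ofBijective (Algebra.ofId k (R ⧸ m))
    IsAlgClosed.algebraMap_bijective_of_isIntegral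
  refine ⟨(e.symm : (R ⧸ m) →ₐ[k] k).comp (Ideal.Quotient.mkₐ k m), ?_⟩
  ext r
  simp [RingHom.mem_ker, Ideal.Quotient.eq_zero_iff_mem]

section Liouville

variable {K : Type*} [Field K] {A B : K}

lemma equation_curve_iff {S : Type*} [CommRing S] {a b x y : S} :
    (curve a b).Equation x y ↔ y ^ 2 = x ^ 3 + a * x + b := by
  simp [WeierstrassCurve.Affine.equation_iff]

lemma nonsingular_of_equation (h2 : (2 : K) ≠ 0) (hE : 4 * A ^ 3 + 27 * B ^ 2 ≠ 0) {x y : K}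
    (h : (curve A B).Equation x y) : (curve A B).Nonsingular x y := by
  have hΔ : (curve A B).Δ = -2 ^ 4 * (4 * A ^ 3 + 27 * B ^ 2) := by
    simp only [WeierstrassCurve.Δ, WeierstrassCurve.b₂, WeierstrassCurve.b₄, WeierstrassCurve.b₆,
      WeierstrassCurve.b₈]
    ring
  refine (WeierstrassCurve.Affine.equation_iff_nonsingular_of_Δ_ne_zero ?_).mp h
  rw [hΔ]
  exact mul_ne_zero (neg_ne_zero.mpr (pow_ne_zero _ h2)) hE

lemma ringCoords_equation : ringCoords A B 1 ^ 2 = ringCoords A B 0 ^ 3 +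
    algebraMap K _ A * ringCoords A B 0 + algebraMap K _ B := by
  apply FaithfulSMul.algebraMap_injective _ (curve A B).FunctionField
  simp only [map_add, map_mul, map_pow]
  exact yF_sq

open scoped Polynomial in
instance : Algebra.FiniteType K (curve A B).CoordinateRing :=
  have : Module.Finite K[X] (curve A B).CoordinateRing :=
    .of_basis (CoordinateRing.basis (curve A B))
  Algebra.FiniteType.trans (S := K[X]) inferInstance inferInstance

lemma exists_point_of_isMaximal [IsAlgClosed K] (h2 : (2 : K) ≠ 0)
    (hE : 4 * A ^ 3 + 27 * B ^ 2 ≠ 0) (m : Ideal (curve A B).CoordinateRing) [m.IsMaximal] :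
    ∃ P : (curve A B).Point, ∀ N : MvPolynomial (Fin 3) K,
      aeval (ringCoords A B) N ∈ m → eval (coords P) N = 0 := by
  obtain ⟨φ, hφ⟩ := exists_algHom_ker_eq (k := K) m
  have hxy : (curve A B).Equation (φ (ringCoords A B 0)) (φ (ringCoords A B 1)) := by
    rw [equation_curve_iff, ← map_pow, ringCoords_equation]
    simp
  refine ⟨.some _ _ (nonsingular_of_equation h2 hE hxy), fun N hN => ?_⟩
  have hcoords : (fun i => φ (ringCoords A B i)) =
      coords (.some _ _ (nonsingular_of_equation h2 hE hxy)) := by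
    ext i
    fin_cases i <;> simp [coords, ringCoords]
  rwa [← hφ, RingHom.mem_ker, aeval_apply_algHom_ringCoords, hcoords] at hN

lemma exists_algebraMap_eq_of_forall_hasValueAt [IsAlgClosed K] (h2 : (2 : K) ≠ 0)
    (hE : 4 * A ^ 3 + 27 * B ^ 2 ≠ 0) {g : (curve A B).FunctionField}
    (hg : ∀ P, ∃ c, HasValueAt g P c) : ∃ r, algebraMap (curve A B).CoordinateRing _ r = g := by
  -- The denominators of `g` form an ideal, and no point is a common zero of all of them.
  let I : Ideal (curve A B).CoordinateRing :=
    (1 : Submodule (curve A B).CoordinateRing (curve A B).FunctionField).comap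
      (LinearMap.toSpanSingleton _ _ g)
  have hI (r) : r ∈ I ↔ ∃ s, algebraMap (curve A B).CoordinateRing _ s =
      algebraMap (curve A B).CoordinateRing _ r * g := by
    rw [Submodule.mem_comap, LinearMap.toSpanSingleton_apply, Submodule.mem_one, Algebra.smul_def]
  suffices hI1 : I = ⊤ by
    obtain ⟨r, hr⟩ := (hI 1).mp (hI1 ▸ Submodule.mem_top)
    exact ⟨r, by simpa using hr⟩
  by_contra hI1
  obtain ⟨m, hm, hIm⟩ := Ideal.exists_le_maximal I hI1
  obtain ⟨P, hP⟩ := exists_point_of_isMaximal h2 hE m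
  obtain ⟨_, _, N, D, _, _, hD0, h, -⟩ := hg P
  refine hD0 (hP D (hIm ((hI _).mpr ⟨aeval (ringCoords A B) N, ?_⟩)))
  rw [algebraMap_aeval_ringCoords, algebraMap_aeval_ringCoords, ← h, mul_comm]

lemma poleOrder_le_zero_of_hasValueAt {r : (curve A B).CoordinateRing} {c : K}
    (h : HasValueAt (algebraMap _ (curve A B).FunctionField r) .zero c) : poleOrder r ≤ 0 := by
  obtain ⟨n, N, D, hN, hD, hD0, h, -⟩ := h
  have hr : r * aeval (ringCoords A B) D = aeval (ringCoords A B) N := by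
    apply FaithfulSMul.algebraMap_injective _ (curve A B).FunctionField
    rw [map_mul, algebraMap_aeval_ringCoords, algebraMap_aeval_ringCoords, h]
  have hle := poleOrder_aeval_ringCoords_le (A := A) (B := B) hN
  rw [← hr, poleOrder_mul, poleOrder_aeval_ringCoords hD hD0] at hle
  refine (WithBot.add_le_add_iff_right (WithBot.natCast_ne_bot (3 * n))).mp ?_
  rwa [zero_add]

theorem exists_eq_algebraMap_of_forall_hasValueAt [IsAlgClosed K] (h2 : (2 : K) ≠ 0)
    (hE : 4 * A ^ 3 + 27 * B ^ 2 ≠ 0) {g : (curve A B).FunctionField}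
    (hg : ∀ P, ∃ c, HasValueAt g P c) : ∃ c, g = algebraMap K _ c := by
  obtain ⟨r, rfl⟩ := exists_algebraMap_eq_of_forall_hasValueAt h2 hE hg
  obtain ⟨_, h⟩ := hg .zero
  obtain ⟨c, rfl⟩ := exists_eq_algebraMap_of_poleOrder_le_zero (poleOrder_le_zero_of_hasValueAt h)
  exact ⟨c, (IsScalarTower.algebraMap_apply K _ _ c).symm⟩

end Liouville

section Order

variable {K : Type*} [Field K] {A B : K}

lemma isUniformizerAt_of_chart {t : (curve A B).FunctionField} {P : (curve A B).Point}
    (ht : HasValueAt t P 0)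
    (h : ∀ i, ∃ u c, HasValueAt u P c ∧ chart P i - algebraMap K _ (coords P i) = t * u) :
    IsUniformizerAt t P := by
  have key (N : MvPolynomial (Fin 3) K) : ∃ u c, HasValueAt u P c ∧
      aeval (chart P) N - algebraMap K _ (eval (coords P) N) = t * u := by
    induction N using MvPolynomial.induction_on with
    | C c => exact ⟨0, 0, .zero P, by simp⟩
    | add p q hp hq =>
      obtain ⟨u, c, hu, hp⟩ := hp
      obtain ⟨v, d, hv, hq⟩ := hq
      refine ⟨u + v, _, hu.add hv, ?_⟩
      simp only [map_add, mul_add, ← hp, ← hq]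
      ring
    | mul_X p i hp =>
      obtain ⟨u, c, hu, hp⟩ := hp
      obtain ⟨v, d, hv, hi⟩ := h i
      refine ⟨u * chart P i + algebraMap K _ (eval (coords P) p) * v, _,
        (hu.mul (.chart_apply P i)).add ((HasValueAt.const P _).mul hv), ?_⟩
      simp only [map_mul, MvPolynomial.aeval_X, MvPolynomial.eval_X]
      linear_combination chart P i * hp + algebraMap K _ (eval (coords P) p) * hi
  refine ⟨ht, fun g hg => ?_⟩
  obtain ⟨N, D, hD, h1, h3⟩ := hasValueAt_iff.mp hg
  obtain ⟨u, c, hu, hN⟩ := key N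
  rw [h3, zero_mul, map_zero, sub_zero, ← h1] at hN
  refine ⟨u / aeval (chart P) D, _, hu.div (.aeval_chart P D) hD, ?_⟩
  rw [← mul_div_assoc, eq_div_iff (aeval_chart_ne_zero hD), hN]

lemma HasValueAt.xF {x y : K} (h : (curve A B).Nonsingular x y) :
    HasValueAt (xF A B) (.some x y h) x :=
  HasValueAt.chart_apply (.some x y h) 0

lemma HasValueAt.yF {x y : K} (h : (curve A B).Nonsingular x y) :
    HasValueAt (yF A B) (.some x y h) y :=
  HasValueAt.chart_apply (.some x y h) 1

lemma HasValueAt.xF_div_yF : HasValueAt (DualPairing.xF A B / DualPairing.yF A B) .zero 0 :=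
  HasValueAt.chart_apply .zero 0

lemma HasValueAt.inv_yF : HasValueAt (1 / DualPairing.yF A B) .zero 0 :=
  HasValueAt.chart_apply .zero 2

lemma xF_sub_ne_zero (c : K) : xF A B - algebraMap K _ c ≠ 0 := by
  have hX := (map_ne_zero_iff (algebraMap (curve A B).CoordinateRing (curve A B).FunctionField)
    (FaithfulSMul.algebraMap_injective _ _)).mpr (CoordinateRing.XClass_ne_zero (W' := curve A B) c)
  rwa [CoordinateRing.XClass, map_sub, map_sub, map_sub] at hX

lemma exists_inv_yF_eq : ∃ u : (curve A B).FunctionField, HasValueAt u .zero 1 ∧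
    1 / yF A B = (xF A B / yF A B) ^ 3 * u := by
  have hv := (((HasValueAt.one (A := A) (B := B) .zero).sub (((HasValueAt.const .zero A).mul
    HasValueAt.xF_div_yF).mul HasValueAt.inv_yF)).sub
      ((HasValueAt.const .zero B).mul (HasValueAt.inv_yF.pow 2)))
  have hv0 := hv.ne_zero (by simp)
  have hu := hv.inv (by simp)
  rw [show (1 - A * 0 * 0 - B * 0 ^ 2)⁻¹ = 1 by simp] at hu
  refine ⟨_, hu, ?_⟩
  have hy := yF_ne_zero (A := A) (B := B)
  rw [eq_mul_inv_iff_mul_eq₀ hv0]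
  field_simp
  linear_combination yF_sq (A := A) (B := B)

lemma isUniformizerAt_zero : IsUniformizerAt (xF A B / yF A B) .zero := by
  refine isUniformizerAt_of_chart HasValueAt.xF_div_yF fun i => ?_
  fin_cases i
  · exact ⟨1, 1, .one _, by simp [chart, coords]⟩
  · exact ⟨0, 0, .zero _, by simp [chart, coords]⟩
  · obtain ⟨u, hu, h⟩ := exists_inv_yF_eq (A := A) (B := B)
    refine ⟨_, _, (HasValueAt.xF_div_yF.pow 2).mul hu, ?_⟩
    simp only [chart, coords, Fin.reduceFinMk, Matrix.cons_val, map_zero, sub_zero]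
    rw [h]
    ring

lemma isUniformizerAt_of_Y_ne_zero (h2 : (2 : K) ≠ 0) {x y : K} (h : (curve A B).Nonsingular x y)
    (hy : y ≠ 0) : IsUniformizerAt (xF A B - algebraMap K _ x) (.some x y h) := by
  refine isUniformizerAt_of_chart (by simpa using (HasValueAt.xF h).sub (.const _ x)) fun i => ?_
  fin_cases i
  · exact ⟨1, 1, .one _, by simp [chart, coords]⟩
  · have hx := HasValueAt.xF h
    have hc := HasValueAt.const (.some x y h) x
    have hv := (HasValueAt.yF h).add (.const _ y)
    have hv' : y + y ≠ 0 := by rw [← two_mul]; exact mul_ne_zero h2 hy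
    refine ⟨_, _, ((((hx.pow 2).add (hx.mul hc)).add (hc.pow 2)).add (.const _ A)).div hv hv', ?_⟩
    rw [← mul_div_assoc, eq_div_iff (hv.ne_zero hv')]
    simp only [chart, coords, Fin.reduceFinMk, Matrix.cons_val]
    have he := congrArg (algebraMap K (curve A B).FunctionField) (equation_curve_iff.mp h.1)
    simp only [map_add, map_mul, map_pow] at he
    linear_combination yF_sq (A := A) (B := B) - he
  · exact ⟨0, 0, .zero _, by simp [chart, coords]⟩

lemma three_mul_sq_add_ne_zero {x : K} (h : (curve A B).Nonsingular x 0) : 3 * x ^ 2 + A ≠ 0 := by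
  intro h0
  rcases ((WeierstrassCurve.Affine.nonsingular_iff' _ _).mp h).2 with h' | h'
  · refine h' ?_
    change (0 : K) * 0 - (3 * x ^ 2 + 2 * 0 * x + A) = 0
    linear_combination -h0
  · exact h' (by simp)

lemma exists_xF_sub_eq {x : K} (h : (curve A B).Nonsingular x 0) :
    ∃ u c, HasValueAt u (.some x 0 h) c ∧ c ≠ 0 ∧ xF A B - algebraMap K _ x = yF A B ^ 2 * u := by
  have hx := HasValueAt.xF h
  have hc := HasValueAt.const (.some x 0 h) x
  have hv := (((hx.pow 2).add (hx.mul hc)).add (hc.pow 2)).add (.const _ A)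
  have hv' : x ^ 2 + x * x + x ^ 2 + A ≠ 0 := by
    convert three_mul_sq_add_ne_zero h using 1
    ring
  refine ⟨_, _, hv.inv hv', inv_ne_zero hv', ?_⟩
  rw [eq_mul_inv_iff_mul_eq₀ (hv.ne_zero hv')]
  have he := congrArg (algebraMap K (curve A B).FunctionField) (equation_curve_iff.mp h.1)
  simp only [map_add, map_mul, map_pow, map_zero] at he
  linear_combination -yF_sq (A := A) (B := B) + he

lemma isUniformizerAt_of_Y_eq_zero {x : K} (h : (curve A B).Nonsingular x 0) :
    IsUniformizerAt (yF A B) (.some x 0 h) := by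
  refine isUniformizerAt_of_chart (.yF h) fun i => ?_
  fin_cases i
  · obtain ⟨u, c, hu, -, he⟩ := exists_xF_sub_eq h
    exact ⟨_, _, (HasValueAt.yF h).mul hu, by simp [chart, coords, he, pow_two, mul_assoc]⟩
  · exact ⟨1, 1, .one _, by simp [chart, coords]⟩
  · exact ⟨0, 0, .zero _, by simp [chart, coords]⟩

lemma xF_ne_zero : xF A B ≠ 0 := by
  simpa using xF_sub_ne_zero (A := A) (B := B) 0

lemma exists_isUniformizerAt (h2 : (2 : K) ≠ 0) (P : (curve A B).Point) :
    ∃ t, IsUniformizerAt t P ∧ t ≠ 0 := by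
  match P with
  | .zero => exact ⟨_, isUniformizerAt_zero, div_ne_zero xF_ne_zero yF_ne_zero⟩
  | .some x y h =>
    by_cases hy : y = 0
    · subst hy
      exact ⟨_, isUniformizerAt_of_Y_eq_zero h, yF_ne_zero⟩
    · exact ⟨_, isUniformizerAt_of_Y_ne_zero h2 h hy, xF_sub_ne_zero x⟩

variable {P : (curve A B).Point} {t t' f g : (curve A B).FunctionField} {m n : ℤ} {c : K}

lemma IsUniformizerAt.ne_zero (h2 : (2 : K) ≠ 0) (ht : IsUniformizerAt t P) : t ≠ 0 := by
  obtain ⟨s, hs, hs0⟩ := exists_isUniformizerAt h2 P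
  obtain ⟨u, c, -, h⟩ := ht.2 s hs.1
  rintro rfl
  exact hs0 (by simpa using h)

lemma IsUniformizerAt.exists_eq_mul (h2 : (2 : K) ≠ 0) (ht : IsUniformizerAt t P)
    (ht' : IsUniformizerAt t' P) : ∃ u c, HasValueAt u P c ∧ c ≠ 0 ∧ t' = t * u := by
  obtain ⟨u, c, hu, h⟩ := ht.2 t' ht'.1
  obtain ⟨v, d, hv, h'⟩ := ht'.2 t ht.1
  refine ⟨u, c, hu, ?_, h⟩
  have h1 : u * v = 1 := by
    rw [h, mul_assoc] at h'
    exact mul_left_cancel₀ (ht.ne_zero h2) (by rw [← h', mul_one])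
  have := hu.mul hv
  rw [h1] at this
  exact left_ne_zero_of_mul ((this.unique (.one P)).trans_ne one_ne_zero)

lemma HasOrderAt.exists_eq (h2 : (2 : K) ≠ 0) (hf : HasOrderAt f P n) (ht : IsUniformizerAt t P) :
    ∃ u c, HasValueAt u P c ∧ c ≠ 0 ∧ f = t ^ n * u := by
  obtain ⟨t', u, c, ht', hu, hc, rfl⟩ := hf
  obtain ⟨v, d, hv, hd, rfl⟩ := ht.exists_eq_mul h2 ht'
  exact ⟨_, _, (hv.zpow hd n).mul hu, mul_ne_zero (zpow_ne_zero n hd) hc,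
    by rw [mul_zpow, mul_assoc]⟩

lemma HasOrderAt.ne_zero (h2 : (2 : K) ≠ 0) (hf : HasOrderAt f P n) : f ≠ 0 := by
  obtain ⟨t, u, c, ht, hu, hc, rfl⟩ := hf
  exact mul_ne_zero (zpow_ne_zero n (ht.ne_zero h2)) (hu.ne_zero hc)

lemma HasOrderAt.mul (h2 : (2 : K) ≠ 0) (hf : HasOrderAt f P m) (hg : HasOrderAt g P n) :
    HasOrderAt (f * g) P (m + n) := by
  obtain ⟨t, u, c, ht, hu, hc, rfl⟩ := hf
  obtain ⟨v, d, hv, hd, rfl⟩ := hg.exists_eq h2 ht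
  refine ⟨t, u * v, c * d, ht, hu.mul hv, mul_ne_zero hc hd, ?_⟩
  rw [zpow_add₀ (ht.ne_zero h2)]
  ring

lemma HasOrderAt.inv (hf : HasOrderAt f P m) : HasOrderAt f⁻¹ P (-m) := by
  obtain ⟨t, u, c, ht, hu, hc, rfl⟩ := hf
  exact ⟨t, u⁻¹, c⁻¹, ht, hu.inv hc, inv_ne_zero hc, by rw [mul_inv, zpow_neg]⟩

lemma HasOrderAt.div (h2 : (2 : K) ≠ 0) (hf : HasOrderAt f P m) (hg : HasOrderAt g P n) :
    HasOrderAt (f / g) P (m - n) := by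
  simpa only [div_eq_mul_inv, sub_eq_add_neg] using hf.mul h2 hg.inv

lemma HasValueAt.hasOrderAt_zero (h2 : (2 : K) ≠ 0) (hf : HasValueAt f P c) (hc : c ≠ 0) :
    HasOrderAt f P 0 := by
  obtain ⟨t, ht, -⟩ := exists_isUniformizerAt h2 P
  exact ⟨t, f, c, ht, hf, hc, by simp⟩

lemma HasOrderAt.unique (h2 : (2 : K) ≠ 0) (hf : HasOrderAt f P m) (hf' : HasOrderAt f P n) :
    m = n := by
  suffices h : ∀ k : ℤ, HasOrderAt (1 : (curve A B).FunctionField) P k → k ≤ 0 by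
    have hmn := hf.div h2 hf'
    have hnm := hf'.div h2 hf
    rw [div_self (hf.ne_zero h2)] at hmn hnm
    have hmn_le := h _ hmn
    have hnm_le := h _ hnm
    omega
  rintro k ⟨t, u, c, ht, hu, -, h⟩
  by_contra hk
  obtain ⟨l, rfl⟩ := Int.eq_ofNat_of_zero_le (not_le.mp hk).le
  rw [zpow_natCast] at h
  have hone := (ht.1.pow l).mul hu
  rw [← h, zero_pow (by omega), zero_mul] at hone
  exact one_ne_zero ((HasValueAt.one P).unique hone)

lemma HasOrderAt.exists_hasValueAt (hf : HasOrderAt f P 0) : ∃ c, HasValueAt f P c ∧ c ≠ 0 := by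
  obtain ⟨t, u, c, -, hu, hc, rfl⟩ := hf
  exact ⟨c, by simpa using hu, hc⟩

lemma HasOrderAt.exists_hasValueAt_invDer_div (h2 : (2 : K) ≠ 0) (p : ℕ) [CharP K p]
    (hf : HasOrderAt f P (p * n)) : ∃ c, HasValueAt (invDer A B h2 f / f) P c := by
  obtain ⟨t, u, c, ht, hu, hc, rfl⟩ := hf
  have hchar : CharP (curve A B).FunctionField p :=
    charP_of_injective_algebraMap (algebraMap K (curve A B).FunctionField).injective p
  obtain ⟨d, hd⟩ := hu.exists_invDer h2
  have h0 := zpow_ne_zero (p * n) (ht.ne_zero h2)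
  have hder : invDer A B h2 (t ^ (p * n)) = 0 := by
    rw [mul_comm, zpow_mul, zpow_natCast, Derivation.leibniz_pow]
    simp [CharP.cast_eq_zero]
  refine ⟨d / c, ?_⟩
  convert hd.div hu hc using 1
  rw [Derivation.leibniz, hder, smul_zero, add_zero, smul_eq_mul, mul_div_mul_left _ _ h0]

end Order

section HasDivisor

variable {K : Type*} [Field K] {A B : K} {f g : (curve A B).FunctionField}
  {D D' : (curve A B).Point →₀ ℤ} {P : (curve A B).Point}

lemma HasDivisor.mul (h2 : (2 : K) ≠ 0) (hf : HasDivisor f D) (hg : HasDivisor g D') :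
    HasDivisor (f * g) (D + D') :=
  fun P => (hf P).mul h2 (hg P)

lemma HasDivisor.inv (hf : HasDivisor f D) : HasDivisor f⁻¹ (-D) :=
  fun P => (hf P).inv

lemma HasDivisor.div (h2 : (2 : K) ≠ 0) (hf : HasDivisor f D) (hg : HasDivisor g D') :
    HasDivisor (f / g) (D - D') :=
  fun P => (hf P).div h2 (hg P)

lemma HasDivisor.one (h2 : (2 : K) ≠ 0) : HasDivisor (1 : (curve A B).FunctionField) 0 :=
  fun P => (HasValueAt.one P).hasOrderAt_zero h2 one_ne_zero

lemma HasDivisor.pow (h2 : (2 : K) ≠ 0) (hf : HasDivisor f D) (n : ℕ) :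
    HasDivisor (f ^ n) (n • D) := by
  induction n with
  | zero => simpa using HasDivisor.one h2
  | succ n ih => simpa only [pow_succ, succ_nsmul] using ih.mul h2 hf

lemma HasDivisor.ne_zero (h2 : (2 : K) ≠ 0) (hf : HasDivisor f D) : f ≠ 0 :=
  (hf .zero).ne_zero h2

lemma HasDivisor.value_ne_zero {c : K} (hf : HasDivisor f D) (hP : D P = 0)
    (hc : HasValueAt f P c) : c ≠ 0 := by
  obtain ⟨d, hd, hd0⟩ := (hP ▸ hf P).exists_hasValueAt
  rwa [hc.unique hd]

end HasDivisor

section PointDivisor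

variable {K : Type*} [Field K] {A B : K} {P X : (curve A B).Point}

/-- The divisor `(P) - (O)`, which represents the point `P` in the divisor class group. -/
noncomputable def pointDivisor (P : (curve A B).Point) : (curve A B).Point →₀ ℤ :=
  Finsupp.single P 1 - Finsupp.single 0 1

lemma pointDivisor_zero : pointDivisor (0 : (curve A B).Point) = 0 :=
  sub_self _

lemma pointDivisor_apply_zero (hP : P ≠ 0) : pointDivisor P 0 = -1 := by
  rw [pointDivisor, Finsupp.sub_apply, Finsupp.single_eq_of_ne hP.symm, Finsupp.single_eq_same,
    zero_sub]

lemma pointDivisor_apply_of_ne_zero (hX : X ≠ 0) : pointDivisor P X = Finsupp.single P 1 X := by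
  rw [pointDivisor, Finsupp.sub_apply, Finsupp.single_eq_of_ne hX, sub_zero]

lemma equivMapDomain_neg_pointDivisor :
    (pointDivisor P).equivMapDomain (Equiv.neg _) = pointDivisor (-P) := by
  rw [← Finsupp.domCongr_apply, pointDivisor, map_sub, Finsupp.domCongr_apply,
    Finsupp.domCongr_apply, Finsupp.equivMapDomain_single, Finsupp.equivMapDomain_single]
  rfl

lemma sum_pointDivisor (P : (curve A B).Point) : ((pointDivisor P).sum fun _ n => n) = 0 := by
  rw [pointDivisor, Finsupp.sum_sub_index fun _ _ _ => rfl]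
  simp

lemma sum_pointDivisor_smul [DecidableEq K] (P : (curve A B).Point) :
    ((pointDivisor P).sum fun X n => n • X) = P := by
  rw [pointDivisor, Finsupp.sum_sub_index fun _ _ _ => sub_smul _ _ _]
  simp

end PointDivisor

section Lines

variable {K : Type*} [Field K] {A B : K}

/-- The function `L 0 * x + L 1 * y + L 2` on `E` that corresponds to the linear form `L`. -/
noncomputable def formFun (A B : K) (L : Fin 3 → K) : (curve A B).FunctionField :=
  algebraMap K _ (L 0) * xF A B + algebraMap K _ (L 1) * yF A B + algebraMap K _ (L 2)

lemma hasValueAt_formFun (L : Fin 3 → K) {x y : K} (h : (curve A B).Nonsingular x y) :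
    HasValueAt (formFun A B L) (.some x y h) (L 0 * x + L 1 * y + L 2) :=
  (((HasValueAt.const _ _).mul (.xF h)).add ((HasValueAt.const _ _).mul (.yF h))).add (.const _ _)

lemma formFun_vertical_zero : formFun A B (vertical (0 : (curve A B).Point)) = 1 := by
  simp [formFun, vertical]

lemma formFun_vertical_some {x y : K} (h : (curve A B).Nonsingular x y) :
    formFun A B (vertical (.some x y h)) = xF A B - algebraMap K _ x := by
  simp [formFun, vertical, sub_eq_add_neg]

lemma neg_some {x y : K} (h : (curve A B).Nonsingular x y) :
    ∃ h', -(Point.some x y h) = .some x (-y) h' := by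
  have hneg := Point.neg_some h
  simp only [WeierstrassCurve.Affine.negY, zero_mul, sub_zero] at hneg
  exact ⟨_, hneg⟩

lemma vertical_neg (P : (curve A B).Point) : vertical (-P) = vertical P := by
  match P with
  | .zero => rfl
  | .some x y h => rfl

lemma some_eq_neg_self_iff (h2 : (2 : K) ≠ 0) {x y : K} (h : (curve A B).Nonsingular x y) :
    (Point.some x y h) = -.some x y h ↔ y = 0 := by
  obtain ⟨h', hneg⟩ := neg_some h
  simp only [hneg, Point.some.injEq, true_and]
  rw [eq_neg_iff_add_eq_zero, ← two_mul, mul_eq_zero, or_iff_right h2]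

lemma hasOrderAt_inv_yF : HasOrderAt (1 / yF A B) .zero 3 := by
  obtain ⟨u, hu, h⟩ := exists_inv_yF_eq (A := A) (B := B)
  exact ⟨_, u, 1, isUniformizerAt_zero, hu, one_ne_zero, by rw [h]; norm_cast⟩

lemma hasOrderAt_xF_sub_zero (h2 : (2 : K) ≠ 0) (x : K) :
    HasOrderAt (xF A B - algebraMap K _ x) .zero (-2) := by
  obtain ⟨u, hu, h⟩ := exists_inv_yF_eq (A := A) (B := B)
  have hv := (HasValueAt.one (A := A) (B := B) .zero).sub ((HasValueAt.const .zero x).mul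
    ((HasValueAt.xF_div_yF.pow 2).mul hu))
  have hnum : HasOrderAt (xF A B / yF A B * _) .zero 1 :=
    ⟨_, _, _, isUniformizerAt_zero, hv, by simp, by rw [zpow_one]⟩
  convert hnum.div h2 hasOrderAt_inv_yF using 1
  swap; · norm_num
  rw [eq_div_iff (one_div_ne_zero yF_ne_zero)]
  linear_combination -algebraMap K (curve A B).FunctionField x * h

lemma hasOrderAt_xF_sub_of_Y_ne_zero (h2 : (2 : K) ≠ 0) {x y : K}
    (h : (curve A B).Nonsingular x y) (hy : y ≠ 0) :
    HasOrderAt (xF A B - algebraMap K _ x) (.some x y h) 1 :=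
  ⟨_, 1, 1, isUniformizerAt_of_Y_ne_zero h2 h hy, .one _, one_ne_zero, by simp⟩

lemma hasOrderAt_xF_sub_of_Y_eq_zero {x : K} (h : (curve A B).Nonsingular x 0) :
    HasOrderAt (xF A B - algebraMap K _ x) (.some x 0 h) 2 := by
  obtain ⟨u, c, hu, hc, he⟩ := exists_xF_sub_eq h
  exact ⟨_, u, c, isUniformizerAt_of_Y_eq_zero h, hu, hc, by rw [he]; norm_cast⟩

lemma hasOrderAt_vertical_self (h2 : (2 : K) ≠ 0) {P : (curve A B).Point} (hP : P ≠ 0) :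
    HasOrderAt (formFun A B (vertical P)) P (1 + Finsupp.single (-P) 1 P) := by
  match P with
  | .zero => exact absurd rfl hP
  | .some x y h =>
    rw [formFun_vertical_some]
    by_cases hy : y = 0
    · rw [← (some_eq_neg_self_iff h2 h).mpr hy, Finsupp.single_eq_same, one_add_one_eq_two]
      subst hy
      exact hasOrderAt_xF_sub_of_Y_eq_zero h
    · rw [Finsupp.single_eq_of_ne (mt (some_eq_neg_self_iff h2 h).mp hy), add_zero]
      exact hasOrderAt_xF_sub_of_Y_ne_zero h2 h hy

lemma hasOrderAt_vertical_of_ne (h2 : (2 : K) ≠ 0) {P X : (curve A B).Point} (hP : P ≠ 0)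
    (hX : X ≠ 0) (hXP : X ≠ P) (hXnegP : X ≠ -P) :
    HasOrderAt (formFun A B (vertical P)) X 0 := by
  classical
  match P, X with
  | .zero, _ => exact absurd rfl hP
  | _, .zero => exact absurd rfl hX
  | .some x₀ y₀ h₀, .some x y h =>
    have hx : x ≠ x₀ := fun hx => (Point.X_eq_iff.mp hx).elim hXP hXnegP
    rw [formFun_vertical_some]
    exact ((HasValueAt.xF h).sub (.const _ x₀)).hasOrderAt_zero h2 (sub_ne_zero.mpr hx)

theorem hasDivisor_vertical (h2 : (2 : K) ≠ 0) (P : (curve A B).Point) :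
    HasDivisor (formFun A B (vertical P)) (pointDivisor P + pointDivisor (-P)) := by
  classical
  obtain rfl | hP := eq_or_ne P 0
  · rw [formFun_vertical_zero, neg_zero, pointDivisor_zero, add_zero]
    exact .one h2
  intro X
  rw [Finsupp.add_apply]
  obtain rfl | hX := eq_or_ne X 0
  · rw [pointDivisor_apply_zero hP, pointDivisor_apply_zero (neg_ne_zero.mpr hP)]
    match P with
    | .zero => exact absurd rfl hP
    | .some x y h => exact formFun_vertical_some h ▸ hasOrderAt_xF_sub_zero h2 x
  rw [pointDivisor_apply_of_ne_zero hX, pointDivisor_apply_of_ne_zero hX]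
  obtain rfl | hXP := eq_or_ne X P
  · rw [Finsupp.single_eq_same]
    exact hasOrderAt_vertical_self h2 hX
  obtain rfl | hXnegP := eq_or_ne X (-P)
  · rw [Finsupp.single_eq_same, add_comm]
    simpa only [vertical_neg, neg_neg] using hasOrderAt_vertical_self h2 hX
  · rw [Finsupp.single_eq_of_ne hXP, Finsupp.single_eq_of_ne hXnegP, add_zero]
    exact hasOrderAt_vertical_of_ne h2 hP hX hXP hXnegP

lemma hasOrderAt_formFun_zero (h2 : (2 : K) ≠ 0) (m c : K) :
    HasOrderAt (formFun A B ![m, 1, c]) .zero (-3) := by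
  have hv := ((HasValueAt.one (A := A) (B := B) .zero).add ((HasValueAt.const .zero m).mul
    HasValueAt.xF_div_yF)).add ((HasValueAt.const .zero c).mul HasValueAt.inv_yF)
  have hy := yF_ne_zero (A := A) (B := B)
  convert (hv.hasOrderAt_zero h2 (by simp)).div h2 hasOrderAt_inv_yF using 1
  swap; · norm_num
  simp only [formFun, Matrix.cons_val, map_one]
  field_simp
  ring

lemma hasOrderAt_formFun_of_Y_eq_zero (m : K) {x c : K} (h : (curve A B).Nonsingular x 0)
    (hc : m * x + c = 0) : HasOrderAt (formFun A B ![m, 1, c]) (.some x 0 h) 1 := by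
  obtain ⟨u, _, hu, -, hxu⟩ := exists_xF_sub_eq h
  refine ⟨_, _, _, isUniformizerAt_of_Y_eq_zero h,
    (HasValueAt.one _).add (((HasValueAt.const _ m).mul (.yF h)).mul hu), by simp, ?_⟩
  have hcF := congrArg (algebraMap K (curve A B).FunctionField) hc
  simp only [map_add, map_mul, map_zero] at hcF
  simp only [formFun, Matrix.cons_val, map_one, zpow_one]
  linear_combination hcF + algebraMap K (curve A B).FunctionField m * hxu

lemma HasOrderAt.of_mul_right (h2 : (2 : K) ≠ 0) {f g : (curve A B).FunctionField}
    {P : (curve A B).Point} {m n : ℤ} (hfg : HasOrderAt (f * g) P (m + n))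
    (hg : HasOrderAt g P n) : HasOrderAt f P m := by
  simpa [hg.ne_zero h2] using hfg.div h2 hg

/-- A line is determined by its conjugate under `y ↦ -y`: away from the `2`-torsion, a zero of one
of the two is not a zero of the other. -/
lemma hasDivisor_formFun_of_mul_conj (h2 : (2 : K) ≠ 0) {m c : K} {D : (curve A B).Point →₀ ℤ}
    (hmul : HasDivisor (formFun A B ![m, 1, c] * formFun A B ![-m, 1, -c])
      (D + D.equivMapDomain (Equiv.neg _))) (hD0 : D 0 = -3)
    (hD : ∀ x y h, D (.some x y h) ≠ 0 → m * x + y + c = 0) :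
    HasDivisor (formFun A B ![m, 1, c]) D := by
  intro X
  match X with
  | .zero => exact hD0 ▸ hasOrderAt_formFun_zero h2 m c
  | .some x y h =>
    have hX := hmul (.some x y h)
    obtain ⟨h', hneg⟩ := neg_some h
    simp only [Finsupp.coe_add, Pi.add_apply, Finsupp.equivMapDomain_apply, Equiv.neg_symm,
      Equiv.neg_apply, hneg] at hX
    have hv := hasValueAt_formFun ![m, 1, c] h
    have hv' := hasValueAt_formFun ![-m, 1, -c] h
    simp only [Matrix.cons_val, one_mul] at hv hv'
    by_cases hl : m * x + y + c = 0
    · by_cases hl' : m * x + -y + c = 0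
      · obtain rfl : y = 0 :=
          (mul_eq_zero.mp (by linear_combination hl - hl' : 2 * y = 0)).resolve_left h2
        have hord := hasOrderAt_formFun_of_Y_eq_zero m h (c := c) (by linear_combination hl)
        have hord' := hasOrderAt_formFun_of_Y_eq_zero (-m) h (c := -c) (by linear_combination -hl)
        have hsum := hX.unique h2 (hord.mul h2 hord')
        simp only [neg_zero] at hsum
        exact (by omega : D (.some x 0 h) = 1) ▸ hord
      · rw [not_imp_comm.mp (hD x (-y) h') hl'] at hX
        exact hX.of_mul_right h2
          (hv'.hasOrderAt_zero h2 fun h0 => hl' (by linear_combination -h0))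
    · exact not_imp_comm.mp (hD x y h) hl ▸ hv.hasOrderAt_zero h2 hl

end Lines

section LineThrough

variable {K : Type*} [Field K] [DecidableEq K] {A B : K} {x₁ x₂ y₁ y₂ : K}

lemma slope_mul_sub (h₁ : (curve A B).Equation x₁ y₁) (h₂ : (curve A B).Equation x₂ y₂)
    (hxy : ¬(x₁ = x₂ ∧ y₁ = -y₂)) : (curve A B).slope x₁ x₂ y₁ y₂ * (x₁ - x₂) = y₁ - y₂ := by
  by_cases hx : x₁ = x₂
  · have hy := WeierstrassCurve.Affine.Y_eq_of_Y_ne h₁ h₂ hx fun hy =>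
      hxy ⟨hx, by simpa [WeierstrassCurve.Affine.negY] using hy⟩
    rw [hx, hy, sub_self, sub_self, mul_zero]
  · rw [WeierstrassCurve.Affine.slope_of_X_ne hx, div_mul_cancel₀ _ (sub_ne_zero.mpr hx)]

lemma formFun_line_mul_conj (h₁ : (curve A B).Equation x₁ y₁) (h₂ : (curve A B).Equation x₂ y₂)
    (hxy : ¬(x₁ = x₂ ∧ y₁ = -y₂)) {m : K} (hm : m = (curve A B).slope x₁ x₂ y₁ y₂) :
    formFun A B ![-m, 1, m * x₁ - y₁] * formFun A B ![- -m, 1, -(m * x₁ - y₁)] =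
      (xF A B - algebraMap K _ x₁) * (xF A B - algebraMap K _ x₂) *
        (xF A B - algebraMap K _ ((curve A B).addX x₁ x₂ m)) := by
  subst hm
  have h := congrArg (Polynomial.aeval (xF A B)) (WeierstrassCurve.Affine.addPolynomial_slope h₁ h₂
    (by simpa [WeierstrassCurve.Affine.negY] using hxy))
  simp only [WeierstrassCurve.Affine.addPolynomial, WeierstrassCurve.Affine.linePolynomial,
    WeierstrassCurve.Affine.polynomial, map_zero, zero_mul, add_zero, map_add, map_pow, map_mul,
    Polynomial.eval_sub, Polynomial.eval_pow, Polynomial.eval_X, Polynomial.eval_add,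
    Polynomial.eval_C, Polynomial.eval_mul, Polynomial.aeval_C,
    Polynomial.aeval_X, WeierstrassCurve.Affine.addX, sub_zero, map_sub, Polynomial.aeval_neg] at h
  simp only [formFun, Fin.isValue, Matrix.cons_val_zero, map_neg, neg_mul, Matrix.cons_val_one,
    map_one, one_mul, Matrix.cons_val, map_sub, map_mul, neg_neg, neg_sub,
    WeierstrassCurve.Affine.addX, zero_mul, add_zero, sub_zero, map_pow]
  linear_combination -h + yF_sq (A := A) (B := B)

lemma neg_add_some (h₁ : (curve A B).Nonsingular x₁ y₁) (h₂ : (curve A B).Nonsingular x₂ y₂)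
    (hxy : ¬(x₁ = x₂ ∧ y₁ = -y₂)) {m : K} (hm : m = (curve A B).slope x₁ x₂ y₁ y₂) :
    ∃ h, -(Point.some x₁ y₁ h₁ + .some x₂ y₂ h₂) =
      .some ((curve A B).addX x₁ x₂ m) (m * ((curve A B).addX x₁ x₂ m - x₁) + y₁) h := by
  subst hm
  have hxy' : ¬(x₁ = x₂ ∧ y₁ = (curve A B).negY x₂ y₂) := by
    simpa [WeierstrassCurve.Affine.negY] using hxy
  refine ⟨WeierstrassCurve.Affine.nonsingular_negAdd h₁ h₂ hxy', ?_⟩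
  rw [Point.add_some hxy', Point.neg_some]
  congr 1
  exact WeierstrassCurve.Affine.negY_negY ..

lemma hasDivisor_line_some (h2 : (2 : K) ≠ 0) (h₁ : (curve A B).Nonsingular x₁ y₁)
    (h₂ : (curve A B).Nonsingular x₂ y₂) (hxy : ¬(x₁ = x₂ ∧ y₁ = -y₂)) :
    HasDivisor (formFun A B (line (.some x₁ y₁ h₁) (.some x₂ y₂ h₂)))
      (pointDivisor (.some x₁ y₁ h₁) + pointDivisor (.some x₂ y₂ h₂) +
        pointDivisor (-(.some x₁ y₁ h₁ + .some x₂ y₂ h₂))) := by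
  simp only [line, if_neg hxy]
  have hslope := slope_mul_sub h₁.1 h₂.1 hxy
  generalize hm : (curve A B).slope x₁ x₂ y₁ y₂ = m at hslope ⊢
  have hconj := formFun_line_mul_conj h₁.1 h₂.1 hxy hm.symm
  obtain ⟨h₃, hsum⟩ := neg_add_some h₁ h₂ hxy hm.symm
  rw [hsum]
  generalize (curve A B).addX x₁ x₂ m = x₃ at hconj h₃ hsum ⊢
  have hsome_ne_zero {x y : K} (h : (curve A B).Nonsingular x y) : Point.some x y h ≠ 0 := nofun
  refine hasDivisor_formFun_of_mul_conj h2 ?_ ?_ fun x y h hD => ?_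
  · have hprod := ((hasDivisor_vertical h2 (.some x₁ y₁ h₁)).mul h2
      (hasDivisor_vertical h2 (.some x₂ y₂ h₂))).mul h2 (hasDivisor_vertical h2 (.some _ _ h₃))
    simp only [formFun_vertical_some] at hprod
    rw [hconj]
    convert hprod using 1
    rw [← Finsupp.domCongr_apply, map_add, map_add]
    simp only [Finsupp.domCongr_apply, equivMapDomain_neg_pointDivisor]
    abel
  · simp [pointDivisor_apply_zero (hsome_ne_zero _)]
  · contrapose! hD
    have hne {x' y' : K} (h' : (curve A B).Nonsingular x' y')
        (hl : -m * x' + y' + (m * x₁ - y₁) = 0) : Point.some x y h ≠ .some x' y' h' := by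
      rintro ⟨⟩
      exact hD hl
    simp [pointDivisor_apply_of_ne_zero (hsome_ne_zero h), hne h₁ (by ring),
      hne h₂ (by linear_combination hslope), hne h₃ (by ring)]

theorem hasDivisor_line (h2 : (2 : K) ≠ 0) (P Q : (curve A B).Point) :
    HasDivisor (formFun A B (line P Q))
      (pointDivisor P + pointDivisor Q + pointDivisor (-(P + Q))) := by
  match P, Q with
  | .zero, Q =>
    simpa [← Point.zero_def, pointDivisor_zero, line] using hasDivisor_vertical h2 Q
  | .some x₁ y₁ h₁, .zero =>
    rw [← Point.zero_def, add_zero, pointDivisor_zero, add_zero]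
    exact hasDivisor_vertical h2 (.some x₁ y₁ h₁)
  | .some x₁ y₁ h₁, .some x₂ y₂ h₂ =>
    by_cases hxy : x₁ = x₂ ∧ y₁ = -y₂
    · obtain ⟨h', hneg⟩ := neg_some h₁
      have hQ : Point.some x₂ y₂ h₂ = -.some x₁ y₁ h₁ := by
        rw [hneg]
        simp [hxy]
      have hL : line (.some x₁ y₁ h₁) (.some x₂ y₂ h₂) = vertical (.some x₁ y₁ h₁) := by
        simp only [line, if_pos hxy, vertical]
      rw [hL, hQ, add_neg_cancel, neg_zero, pointDivisor_zero, add_zero]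
      exact hasDivisor_vertical h2 (.some x₁ y₁ h₁)
    · exact hasDivisor_line_some h2 h₁ h₂ hxy

theorem hasDivisor_line_div_vertical (h2 : (2 : K) ≠ 0) (P Q : (curve A B).Point) :
    HasDivisor (formFun A B (line P Q) / formFun A B (vertical (P + Q)))
      (pointDivisor P + pointDivisor Q - pointDivisor (P + Q)) := by
  convert (hasDivisor_line h2 P Q).div h2 (hasDivisor_vertical h2 (P + Q)) using 1
  abel

end LineThrough

section DivisorClasses

variable {K : Type*} [Field K] {A B : K}

/-- The group of principal divisors on `E`. -/
def principalDivisors (A B : K) (h2 : (2 : K) ≠ 0) : AddSubgroup ((curve A B).Point →₀ ℤ) where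
  carrier := {D | ∃ f, HasDivisor f D}
  zero_mem' := ⟨1, HasDivisor.one h2⟩
  add_mem' := fun ⟨f, hf⟩ ⟨g, hg⟩ => ⟨f * g, hf.mul h2 hg⟩
  neg_mem' := fun ⟨f, hf⟩ => ⟨f⁻¹, hf.inv⟩

lemma mem_principalDivisors {h2 : (2 : K) ≠ 0} {D : (curve A B).Point →₀ ℤ} :
    D ∈ principalDivisors A B h2 ↔ ∃ f, HasDivisor f D :=
  Iff.rfl

variable [DecidableEq K]

/-- The class of `(P) - (O)` in the divisor class group, as a homomorphism in `P`. -/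
noncomputable def pointClass (h2 : (2 : K) ≠ 0) :
    (curve A B).Point →+ ((curve A B).Point →₀ ℤ) ⧸ principalDivisors A B h2 :=
  AddMonoidHom.mk' (fun P => pointDivisor P) fun P Q => by
    rw [← QuotientAddGroup.mk_add, eq_comm, QuotientAddGroup.eq_iff_sub_mem]
    exact ⟨_, hasDivisor_line_div_vertical h2 P Q⟩

lemma mk_eq_pointClass_sum (h2 : (2 : K) ≠ 0) (D : (curve A B).Point →₀ ℤ) :
    ((D - Finsupp.single 0 D.degree : (curve A B).Point →₀ ℤ) : _ ⧸ principalDivisors A B h2) =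
      pointClass h2 (Finsupp.linearCombination ℤ id D) := by
  let degreeZeroPart : ((curve A B).Point →₀ ℤ) →+ (curve A B).Point →₀ ℤ :=
    AddMonoidHom.id _ - (Finsupp.singleAddHom 0).comp Finsupp.degree
  suffices (QuotientAddGroup.mk' (principalDivisors A B h2)).comp degreeZeroPart =
      (pointClass h2).comp (Finsupp.linearCombination ℤ id).toAddMonoidHom from
    DFunLike.congr_fun this D
  ext P
  simp [degreeZeroPart, pointClass, pointDivisor]

theorem exists_hasDivisor_sub_pointDivisor (h2 : (2 : K) ≠ 0) {D : (curve A B).Point →₀ ℤ}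
    (hdeg : (D.sum fun _ n => n) = 0) {P : (curve A B).Point}
    (hsum : (D.sum fun X n => n • X) = P) : ∃ g, HasDivisor g (D - pointDivisor P) := by
  have h := mk_eq_pointClass_sum h2 D
  have hdeg' : D.degree = 0 := hdeg
  have hsum' : Finsupp.linearCombination ℤ id D = P := hsum
  rw [hdeg', Finsupp.single_zero, sub_zero, hsum'] at h
  exact mem_principalDivisors.mp ((QuotientAddGroup.eq_iff_sub_mem).mp h)

theorem exists_hasDivisor_nsmul_pointDivisor (h2 : (2 : K) ≠ 0) {n : ℕ} {P : (curve A B).Point}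
    (hP : n • P = 0) : ∃ f, HasDivisor f (n • pointDivisor P) := by
  refine mem_principalDivisors.mp ((QuotientAddGroup.eq_zero_iff (N := principalDivisors A B h2)
    _).mp ?_)
  rw [QuotientAddGroup.mk_nsmul]
  change n • pointClass h2 P = 0
  rw [← map_nsmul, hP, map_zero]

end DivisorClasses

section LogDer

variable {K : Type*} [Field K] {A B : K} {f g : (curve A B).FunctionField}

/-- The logarithmic derivative of `f` with respect to the invariant derivation `2 y d/dx`. -/
noncomputable def logDer (h2 : (2 : K) ≠ 0) (f : (curve A B).FunctionField) :
    (curve A B).FunctionField :=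
  invDer A B h2 f / f

lemma logDer_mul (h2 : (2 : K) ≠ 0) (hf : f ≠ 0) (hg : g ≠ 0) :
    logDer h2 (f * g) = logDer h2 f + logDer h2 g := by
  simp only [logDer, Derivation.leibniz, smul_eq_mul]
  field_simp
  ring

lemma logDer_inv (h2 : (2 : K) ≠ 0) (hf : f ≠ 0) : logDer h2 f⁻¹ = -logDer h2 f := by
  simp only [logDer, Derivation.leibniz_inv, smul_eq_mul]
  field_simp

lemma logDer_div (h2 : (2 : K) ≠ 0) (hf : f ≠ 0) (hg : g ≠ 0) :
    logDer h2 (f / g) = logDer h2 f - logDer h2 g := by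
  rw [div_eq_mul_inv, logDer_mul h2 hf (inv_ne_zero hg), logDer_inv h2 hg, sub_eq_add_neg]

lemma logDer_algebraMap (h2 : (2 : K) ≠ 0) (c : K) :
    logDer h2 (algebraMap K (curve A B).FunctionField c) = 0 := by
  simp [logDer]

lemma logDer_one (h2 : (2 : K) ≠ 0) : logDer h2 (1 : (curve A B).FunctionField) = 0 := by
  simp [logDer]

lemma logDer_pow_char (h2 : (2 : K) ≠ 0) (p : ℕ) [CharP K p] (f : (curve A B).FunctionField) :
    logDer h2 (f ^ p) = 0 := by
  have hchar : CharP (curve A B).FunctionField p :=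
    charP_of_injective_algebraMap (algebraMap K (curve A B).FunctionField).injective p
  simp [logDer, Derivation.leibniz_pow]

/-- The value at `(x, y)` of the logarithmic derivative of the linear form `L` with respect to the
invariant derivation `2 y d/dx`. -/
def formLogDer (A : K) (L : Fin 3 → K) (x y : K) : K :=
  (L 0 * (2 * y) + L 1 * (3 * x ^ 2 + A)) / (L 0 * x + L 1 * y + L 2)

lemma hasValueAt_logDer_formFun (h2 : (2 : K) ≠ 0) {L : Fin 3 → K} {x y : K}
    (h : (curve A B).Nonsingular x y) (hL : L 0 * x + L 1 * y + L 2 ≠ 0) :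
    HasValueAt (logDer h2 (formFun A B L)) (.some x y h) (formLogDer A L x y) := by
  refine HasValueAt.div ?_ (hasValueAt_formFun L h) hL
  convert ((HasValueAt.const _ (L 0)).mul ((HasValueAt.const _ 2).mul (.yF h))).add
    ((HasValueAt.const _ (L 1)).mul (((HasValueAt.const _ 3).mul ((HasValueAt.xF h).pow 2)).add
      (.const _ A))) using 1
  simp only [map_ofNat]
  simp [formFun, invDer_xF, invDer_yF]

lemma yF_mul_ddx_div (h2 : (2 : K) ≠ 0) (f : (curve A B).FunctionField) :
    yF A B * (ddx A B h2 f / f) = logDer h2 f / 2 := by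
  have h2F := two_ne_zero_functionField (A := A) (B := B) h2
  rw [logDer, invDer_apply]
  field_simp

/-- The number `c` is the logarithmic derivative of a function with the divisor `p (P) - p (O)`. In
characteristic `p` this expresses that `c` is the constant attached to the `p`-torsion point `P`. -/
def HasLogDer (h2 : (2 : K) ≠ 0) (p : ℕ) (P : (curve A B).Point) (c : K) : Prop :=
  ∃ f, HasDivisor f (p • pointDivisor P) ∧ logDer h2 f = algebraMap K _ c

variable {h2 : (2 : K) ≠ 0} {p : ℕ} {P P' : (curve A B).Point} {c c' : K}

lemma HasLogDer.zero : HasLogDer (A := A) (B := B) h2 p 0 0 :=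
  ⟨1, by simpa [pointDivisor_zero] using HasDivisor.one h2, by simp [logDer_one]⟩

variable [CharP K p]

lemma HasLogDer.add [DecidableEq K] (hc : HasLogDer h2 p P c) (hc' : HasLogDer h2 p P' c') :
    HasLogDer h2 p (P + P') (c + c') := by
  obtain ⟨f, hf, hfc⟩ := hc
  obtain ⟨f', hf', hfc'⟩ := hc'
  have hg := hasDivisor_line_div_vertical h2 P P'
  have hf0 := hf.ne_zero h2
  have hf0' := hf'.ne_zero h2
  refine ⟨f * f' / (formFun A B (line P P') / formFun A B (vertical (P + P'))) ^ p, ?_, ?_⟩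
  · convert (hf.mul h2 hf').div h2 (hg.pow h2 p) using 1
    rw [← nsmul_add, ← nsmul_sub, sub_sub_cancel]
  · rw [logDer_div h2 (mul_ne_zero hf0 hf0') (pow_ne_zero p (hg.ne_zero h2)), logDer_pow_char,
      sub_zero, logDer_mul h2 hf0 hf0', hfc, hfc', map_add]

variable [IsAlgClosed K]

lemma exists_logDer_eq_algebraMap (h2 : (2 : K) ≠ 0) (hE : 4 * A ^ 3 + 27 * B ^ 2 ≠ 0)
    {D : (curve A B).Point →₀ ℤ} (hf : HasDivisor f (p • D)) :
    ∃ c, logDer h2 f = algebraMap K _ c := by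
  refine exists_eq_algebraMap_of_forall_hasValueAt h2 hE fun P => ?_
  have hP : HasOrderAt f P (p * D P) := by simpa using hf P
  exact hP.exists_hasValueAt_invDer_div h2 p

lemma HasDivisor.exists_eq_algebraMap (h2 : (2 : K) ≠ 0) (hE : 4 * A ^ 3 + 27 * B ^ 2 ≠ 0)
    (hf : HasDivisor f 0) : ∃ c, f = algebraMap K _ c :=
  exists_eq_algebraMap_of_forall_hasValueAt h2 hE fun P =>
    (HasOrderAt.exists_hasValueAt (hf P)).imp fun _ h => h.1

theorem exists_hasLogDer [DecidableEq K] (h2 : (2 : K) ≠ 0) (hE : 4 * A ^ 3 + 27 * B ^ 2 ≠ 0)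
    (hP : p • P = 0) : ∃ c, HasLogDer h2 p P c := by
  obtain ⟨f, hf⟩ := exists_hasDivisor_nsmul_pointDivisor h2 hP
  obtain ⟨c, hc⟩ := exists_logDer_eq_algebraMap h2 hE hf
  exact ⟨c, f, hf, hc⟩

theorem HasLogDer.logDer_eq [DecidableEq K] (hE : 4 * A ^ 3 + 27 * B ^ 2 ≠ 0)
    (hc : HasLogDer h2 p P c) {D : (curve A B).Point →₀ ℤ} (hdeg : (D.sum fun _ n => n) = 0)
    (hsum : (D.sum fun X n => n • X) = P) (hg : HasDivisor g (p • D)) :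
    logDer h2 g = algebraMap K _ c := by
  obtain ⟨f, hf, hfc⟩ := hc
  obtain ⟨u, hu⟩ := exists_hasDivisor_sub_pointDivisor h2 hdeg hsum
  have hconst := (hg.div h2 hf).div h2 (hu.pow h2 p)
  rw [← nsmul_sub, sub_self] at hconst
  obtain ⟨d, hd⟩ := hconst.exists_eq_algebraMap h2 hE
  have hlog := congrArg (logDer h2) hd
  have hg0 := hg.ne_zero h2
  have hf0 := hf.ne_zero h2
  rwa [logDer_div h2 (div_ne_zero hg0 hf0) (pow_ne_zero p (hu.ne_zero h2)),
    logDer_div h2 hg0 hf0, logDer_pow_char, logDer_algebraMap, sub_zero, sub_eq_zero, hfc] at hlog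

lemma HasLogDer.unique (hE : 4 * A ^ 3 + 27 * B ^ 2 ≠ 0) (hc : HasLogDer h2 p P c)
    (hc' : HasLogDer h2 p P c') : c = c' := by
  classical
  obtain ⟨f, hf, hfc⟩ := hc
  have hfc' := hc'.logDer_eq hE (sum_pointDivisor P) (sum_pointDivisor_smul P) hf
  exact (algebraMap K _).injective (hfc.symm.trans hfc')

end LogDer

section Chains

variable {K : Type*} [Field K] {A B : K} [DecidableEq K] {p : ℕ} {P : (curve A B).Point}

/-- The function `h_{i,j}` before the translation, as an element of the function field. -/
noncomputable def hFun (p : ℕ) (P : (curve A B).Point) (i j : ℕ) : (curve A B).FunctionField :=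
  formFun A B (hNum p P i j) / formFun A B (hDen p P i j)

lemma hasDivisor_hFun (h2 : (2 : K) ≠ 0) (hP : p • P = 0) (i j : ℕ) :
    HasDivisor (hFun p P i j)
      (pointDivisor (i • P) + pointDivisor (j • P) - pointDivisor ((i + j) • P)) := by
  by_cases hij : i + j = p
  · have hj : j • P = -(i • P) := by
      rw [eq_neg_iff_add_eq_zero, ← add_nsmul, add_comm, hij, hP]
    have hden : formFun A B (hDen p P i j) = 1 := by simp [hDen, hij, formFun]
    rw [hFun, hNum, if_pos hij, hden, div_one, hj, hij, hP, pointDivisor_zero, sub_zero]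
    exact hasDivisor_vertical h2 (i • P)
  · rw [hFun, hNum, hDen, if_neg hij, if_neg hij, add_nsmul]
    exact hasDivisor_line_div_vertical h2 (i • P) (j • P)

lemma Decomposes.hasDivisor (h2 : (2 : K) ≠ 0) (hP : p • P = 0) {S : Finset ℕ} {M : Multiset ℕ}
    {C : List (ℕ × ℕ)} (h : Decomposes S M C) :
    HasDivisor ((C.map fun s => hFun p P s.1 s.2).prod)
      (M.sum • pointDivisor P - (M.map fun m => pointDivisor (m • P)).sum) := by
  induction h with
  | ones m => simpa using HasDivisor.one h2
  | step _ _ _ _ ih =>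
    rw [List.map_cons, List.prod_cons]
    convert (hasDivisor_hFun h2 hP _ _).mul h2 ih using 1
    simp only [Multiset.sum_cons, Multiset.map_cons, add_assoc]
    abel

theorem IsChainDecomposition.hasDivisor (h2 : (2 : K) ≠ 0) (hP : p • P = 0) {C : List (ℕ × ℕ)}
    (h : IsChainDecomposition p C) :
    HasDivisor ((C.map fun s => hFun p P s.1 s.2).prod) (p • pointDivisor P) := by
  obtain ⟨S, -, h⟩ := h
  simpa [hP, pointDivisor_zero] using h.hasDivisor h2 hP

end Chains

section Infinitesimal

variable {S : Type*} [CommRing S] {a b κ m x y x₁ y₁ x₂ y₂ x₃ y₃ : S}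

/-- The sum of the point `(κ : 1 : 0)` at infinity, where `κ ^ 2 = 0`, and the affine point
`(x, y)`. -/
def shift (a κ x y : S) : Fin 3 → S :=
  ![x - 2 * κ * y, y - κ * (3 * x ^ 2 + a), 1]

lemma addClass_eq_of_addLaw₁ {X Y Z : Fin 3 → S} {u : S} (hu : IsUnit u) (hZ : Z 2 = 1)
    (h : addLaw₁ a b X Y = u • Z) : addClass a b ⟦X⟧ ⟦Y⟧ = ⟦Z⟧ := by
  have hprim : IsPrimitive (addLaw₁ a b X Y) := ⟨2, by simpa [h, hZ] using hu⟩
  change (⟦addRep a b X Y⟧ : PointClass S) = _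
  rw [addRep, if_pos hprim, h]
  exact WeierstrassCurve.Projective.smul_eq Z hu

lemma addClass_infinity_some (hκ : κ ^ 2 = 0) (x y : S) :
    addClass a b ⟦![κ, 1, 0]⟧ ⟦![x, y, 1]⟧ = ⟦shift a κ x y⟧ := by
  refine addClass_eq_of_addLaw₁ isUnit_one.neg rfl ?_
  ext i
  fin_cases i <;> simp [addLaw₁, shift]
  · linear_combination -a * hκ
  · linear_combination -3 * x * y * hκ
  · linear_combination 3 * x * hκ

lemma addClass_some_some (h₁ : (curve a b).Equation x₁ y₁) (h₂ : (curve a b).Equation x₂ y₂)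
    (hx : IsUnit (x₁ - x₂)) (hm : m * (x₁ - x₂) = y₁ - y₂) (hx₃ : x₃ = m ^ 2 - x₁ - x₂)
    (hy₃ : y₃ = -(m * (x₃ - x₁) + y₁)) :
    addClass a b ⟦![x₁, y₁, 1]⟧ ⟦![x₂, y₂, 1]⟧ = ⟦![x₃, y₃, 1]⟧ := by
  rw [equation_curve_iff] at h₁ h₂
  obtain rfl : y₁ = y₂ + m * (x₁ - x₂) := by linear_combination -hm
  subst hx₃ hy₃
  refine addClass_eq_of_addLaw₁ (hx.pow 3).neg rfl ?_
  ext i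
  fin_cases i <;> simp [addLaw₁]
  · linear_combination (x₁ - 2 * x₂) * h₁ + (2 * x₁ - x₂) * h₂
  · linear_combination (y₂ - m * (x₁ - x₂)) * h₁ - (y₂ + 2 * m * (x₁ - x₂)) * h₂
  · linear_combination h₂ - h₁

lemma equation_shift (hκ : κ ^ 2 = 0) (h : (curve a b).Equation x y) :
    WeierstrassCurve.Projective.Equation (curve a b) (shift a κ x y) := by
  rw [equation_curve_iff] at h
  rw [shift, WeierstrassCurve.Projective.equation_some]
  refine equation_curve_iff.mpr ?_
  linear_combination
    h + (9 * x ^ 4 + 6 * a * x ^ 2 + a ^ 2 - 12 * x * y ^ 2 + 8 * κ * y ^ 3) * hκ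

/-- The tangent direction `(2 y, 3 x² + a)` is invariant under translations: if `m` is the slope
at `(x₁, y₁)` and `(x₂, y₂)`, then `m - κ (x₁ - x₃)` is the slope for the shifted point. -/
lemma addClass_shift_some (hκ : κ ^ 2 = 0) (h₁ : (curve a b).Equation x₁ y₁)
    (h₂ : (curve a b).Equation x₂ y₂) (hx : IsUnit (x₁ - x₂)) (hm : m * (x₁ - x₂) = y₁ - y₂)
    (hx₃ : x₃ = m ^ 2 - x₁ - x₂) (hy₃ : y₃ = -(m * (x₃ - x₁) + y₁)) :
    addClass a b ⟦shift a κ x₁ y₁⟧ ⟦![x₂, y₂, 1]⟧ = ⟦shift a κ x₃ y₃⟧ := by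
  have hshift : (curve a b).Equation (x₁ - 2 * κ * y₁) (y₁ - κ * (3 * x₁ ^ 2 + a)) := by
    simpa only [shift, WeierstrassCurve.Projective.equation_some] using equation_shift hκ h₁
  have hunit : IsUnit (x₁ - 2 * κ * y₁ - x₂) := by
    have hnil : IsNilpotent (-(2 * κ * y₁)) := ⟨2, by linear_combination 4 * y₁ ^ 2 * hκ⟩
    convert hnil.isUnit_add_right_of_commute hx (.all _ _) using 1
    ring
  rw [equation_curve_iff] at h₁ h₂
  have htangent : (x₁ - x₂) * (x₁ - x₃) = 3 * x₁ ^ 2 + a - 2 * m * y₁ := by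
    refine hx.mul_left_cancel ?_
    linear_combination
      h₁ - h₂ - (x₁ - x₂) ^ 2 * hx₃ + (2 * y₁ - m * (x₁ - x₂) - (y₁ - y₂)) * hm
  have htangent₃ : (x₃ - x₁) * (x₃ - x₂) = 3 * x₃ ^ 2 + a + 2 * m * y₃ := by
    linear_combination htangent - 2 * (x₃ - x₁) * hx₃ - 2 * m * hy₃
  refine addClass_some_some (m := m - κ * (x₁ - x₃)) hshift
    (equation_curve_iff.mpr h₂) hunit ?_ ?_ ?_
  · linear_combination hm - κ * htangent + 2 * y₁ * (x₁ - x₃) * hκ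
  · linear_combination hx₃ - 2 * κ * hy₃ - (x₁ - x₃) ^ 2 * hκ
  · linear_combination hy₃ + κ * (htangent + htangent₃) + 2 * (x₁ - x₃) * (y₃ - y₁) * hκ

end Infinitesimal

section DualNumbers

variable {K : Type*} [Field K] {A B : K}

lemma smul_eps_sq (k : K) : (k • DualNumber.eps : K[ε]) ^ 2 = 0 := by
  simp [pow_two]

lemma one_sub_smul_eps_mul (c d : K) :
    (1 - c • DualNumber.eps : K[ε]) * (1 - d • DualNumber.eps) = 1 - (c + d) • DualNumber.eps := by
  ext <;> simp [add_comm]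

lemma one_sub_smul_eps_pow (c : K) (n : ℕ) :
    (1 - c • DualNumber.eps : K[ε]) ^ n = 1 - (n * c) • DualNumber.eps := by
  induction n with
  | zero => simp
  | succ n ih => rw [pow_succ, ih, one_sub_smul_eps_mul, Nat.cast_succ, add_one_mul]

lemma algebraMap_mul_one_sub_smul_eps_mul {v : K} (hv : v ≠ 0) (c : K) :
    algebraMap K K[ε] v * (1 - c • DualNumber.eps) *
      (algebraMap K K[ε] v⁻¹ * (1 - (-c) • DualNumber.eps)) = 1 := by
  rw [mul_mul_mul_comm, ← map_mul, mul_inv_cancel₀ hv, one_sub_smul_eps_mul]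
  simp

lemma isUnit_algebraMap_mul_one_sub_smul_eps {v : K} (hv : v ≠ 0) (c : K) :
    IsUnit (algebraMap K K[ε] v * (1 - c • DualNumber.eps)) :=
  .of_mul_eq_one _ (algebraMap_mul_one_sub_smul_eps_mul hv c)

lemma inverse_algebraMap_mul_one_sub_smul_eps {v : K} (hv : v ≠ 0) (c : K) :
    Ring.inverse (algebraMap K K[ε] v * (1 - c • DualNumber.eps)) =
      algebraMap K K[ε] v⁻¹ * (1 - (-c) • DualNumber.eps) := by
  rw [← mul_one (Ring.inverse _), Ring.inverse_mul_eq_iff_eq_mul _ _ _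
    (isUnit_algebraMap_mul_one_sub_smul_eps hv c), algebraMap_mul_one_sub_smul_eps_mul hv]

lemma equation_algebraMap {x y : K} (h : (curve A B).Equation x y) :
    (curve (algebraMap K K[ε] A) (algebraMap K K[ε] B)).Equation (algebraMap K K[ε] x)
      (algebraMap K K[ε] y) := by
  rw [equation_curve_iff] at h ⊢
  simpa only [map_add, map_mul, map_pow] using congrArg (algebraMap K K[ε]) h

/-- Coordinates of the point `O_k + (x, y)` of the canonical lift. -/
noncomputable def dualShift (A k x y : K) : Fin 3 → K[ε] :=
  shift (algebraMap K K[ε] A) (k • DualNumber.eps) (algebraMap K K[ε] x) (algebraMap K K[ε] y)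

lemma dualShift_mem_dualPoints (k : K) {x y : K} (h : (curve A B).Equation x y) :
    (⟦dualShift A k x y⟧ : PointClass K[ε]) ∈ dualPoints A B :=
  ⟨_, rfl, ⟨2, isUnit_one⟩, equation_shift (smul_eps_sq k) (equation_algebraMap h)⟩

lemma liftPt_zero : liftPt (0 : (curve A B).Point) = infPt 0 := by
  change ⟦fun i => algebraMap K K[ε] (![0, 1, 0] i)⟧ = infPt 0
  rw [infPt]
  congr 1
  ext1 i
  fin_cases i <;> simp

lemma liftPt_some {x y : K} (h : (curve A B).Nonsingular x y) :
    liftPt (.some x y h) = ⟦![algebraMap K K[ε] x, algebraMap K K[ε] y, 1]⟧ := by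
  rw [liftPt]
  congr 1
  ext1 i
  fin_cases i <;> simp [coords]

lemma dualAdd_infPt_liftPt_some (k : K) {x y : K} (h : (curve A B).Nonsingular x y) :
    dualAdd A B (infPt k) (liftPt (.some x y h)) = ⟦dualShift A k x y⟧ := by
  rw [liftPt_some]
  exact addClass_infinity_some (smul_eps_sq k) _ _

lemma dualAdd_infPt_infPt (k k' : K) : dualAdd A B (infPt k) (infPt k') = infPt (k + k') := by
  have hprim : ¬IsPrimitive (addLaw₁ (algebraMap K K[ε] A) (algebraMap K K[ε] B)
      ![k • DualNumber.eps, 1, 0] ![k' • DualNumber.eps, 1, 0]) := by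
    rintro ⟨i, hi⟩
    rw [TrivSqZeroExt.isUnit_iff_isUnit_fst] at hi
    fin_cases i <;> simp [addLaw₁] at hi
  change (⟦addRep _ _ _ _⟧ : PointClass K[ε]) = _
  rw [addRep, if_neg hprim, infPt]
  congr 1
  ext i <;> fin_cases i <;> simp [addLaw₂]

lemma dualAdd_infPt_zero_liftPt (P : (curve A B).Point) :
    dualAdd A B (infPt 0) (liftPt P) = liftPt P := by
  match P with
  | .zero => rw [← Point.zero_def, liftPt_zero, dualAdd_infPt_infPt, add_zero]
  | .some x y h => rw [dualAdd_infPt_liftPt_some, liftPt_some, dualShift, shift]; simp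

lemma infPt_mem_dualPoints (k : K) : infPt k ∈ dualPoints A B := by
  refine ⟨_, rfl, ⟨1, isUnit_one⟩, ?_⟩
  rw [WeierstrassCurve.Projective.equation_iff]
  simp [pow_succ]

lemma dualAdd_infPt_liftPt_mem_dualPoints (k : K) (P : (curve A B).Point) :
    dualAdd A B (infPt k) (liftPt P) ∈ dualPoints A B := by
  match P with
  | .zero =>
    rw [← Point.zero_def, liftPt_zero, dualAdd_infPt_infPt, add_zero]
    exact infPt_mem_dualPoints k
  | .some x y h =>
    rw [dualAdd_infPt_liftPt_some]
    exact dualShift_mem_dualPoints k h.1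

lemma infPt_injective : Function.Injective (infPt : K → PointClass K[ε]) := by
  intro k k' h
  obtain ⟨u, hu⟩ := Quotient.exact h
  have hu₁ : (u : K[ε]) = 1 := by simpa [Units.smul_def] using congrFun hu 1
  have hu₀ : (u : K[ε]) * k' • DualNumber.eps = k • DualNumber.eps := congrFun hu 0
  rw [hu₁, one_mul] at hu₀
  simpa using (congrArg TrivSqZeroExt.snd hu₀).symm

lemma dualAdd_dualShift_liftPt [DecidableEq K] {x₁ y₁ x₂ y₂ : K}
    (h₁ : (curve A B).Nonsingular x₁ y₁) (h₂ : (curve A B).Nonsingular x₂ y₂) (hx : x₁ ≠ x₂) :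
    ∃ x₃ y₃ h₃, Point.some x₁ y₁ h₁ + .some x₂ y₂ h₂ = .some x₃ y₃ h₃ ∧
      ∀ k, dualAdd A B ⟦dualShift A k x₁ y₁⟧ (liftPt (.some x₂ y₂ h₂)) =
        ⟦dualShift A k x₃ y₃⟧ := by
  have hsub := sub_ne_zero.mpr hx
  refine ⟨_, _, _, Point.add_some (fun h => hx h.1), fun k => ?_⟩
  rw [liftPt_some]
  refine addClass_shift_some (m := algebraMap K K[ε] ((curve A B).slope x₁ x₂ y₁ y₂))
    (smul_eps_sq k) (equation_algebraMap h₁.1) (equation_algebraMap h₂.1) ?_ ?_ ?_ ?_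
  · rw [← map_sub]
    exact hsub.isUnit.map (algebraMap K K[ε])
  · rw [← map_sub, ← map_mul, slope_mul_sub h₁.1 h₂.1 fun h => hx h.1, map_sub]
  · simp [WeierstrassCurve.Affine.addX]
  · simp [WeierstrassCurve.Affine.addY, WeierstrassCurve.Affine.negAddY,
      WeierstrassCurve.Affine.negY]

lemma evalForm_dualShift {L : Fin 3 → K} {x y : K} (hL : L 0 * x + L 1 * y + L 2 ≠ 0) (k : K) :
    evalForm L (dualShift A k x y) = algebraMap K K[ε] (L 0 * x + L 1 * y + L 2) *
      (1 - (k * formLogDer A L x y) • DualNumber.eps) := by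
  have hdiv : (L 0 * x + L 1 * y + L 2) * formLogDer A L x y =
      L 0 * (2 * y) + L 1 * (3 * x ^ 2 + A) := mul_div_cancel₀ _ hL
  have hdiv' := congrArg (algebraMap K K[ε]) hdiv
  simp only [map_add, map_mul, map_pow, map_ofNat] at hdiv'
  simp only [evalForm, Fin.sum_univ_three, dualShift, shift, Algebra.smul_def, map_add, map_mul,
    Matrix.cons_val]
  linear_combination (algebraMap K K[ε] k * DualNumber.eps) * hdiv'

lemma ratio_dualShift {N D : Fin 3 → K} {x y : K} (hN : N 0 * x + N 1 * y + N 2 ≠ 0)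
    (hD : D 0 * x + D 1 * y + D 2 ≠ 0) (k : K) :
    ratio N D ⟦dualShift A k x y⟧ =
      algebraMap K K[ε] ((N 0 * x + N 1 * y + N 2) / (D 0 * x + D 1 * y + D 2)) *
        (1 - (k * (formLogDer A N x y - formLogDer A D x y)) • DualNumber.eps) := by
  change evalForm N _ * Ring.inverse (evalForm D _) = _
  rw [evalForm_dualShift hN, evalForm_dualShift hD, inverse_algebraMap_mul_one_sub_smul_eps hD,
    mul_mul_mul_comm, ← map_mul, one_sub_smul_eps_mul, div_eq_mul_inv, mul_sub k,
    ← sub_eq_add_neg]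

end DualNumbers

section Evaluation

variable {K : Type*} [Field K] [DecidableEq K] {A B : K} {p : ℕ} {P R T W : (curve A B).Point}
  {x y : K} {h : (curve A B).Nonsingular x y}

/-- The points `R` and `T` that enter the definition of the pairing: a `p`-torsion point that is not
a `2`-torsion point, and a point of order two. -/
structure IsAdmissible (p : ℕ) (R T : (curve A B).Point) : Prop where
  nsmul_left : p • R = 0
  two_nsmul_left : 2 • R ≠ 0
  two_nsmul_right : 2 • T = 0
  right_ne_zero : T ≠ 0

lemma IsAdmissible.nsmul_sub_ne_zero (hp : Odd p) (hRT : IsAdmissible p R T) :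
    p • (R + -T) ≠ 0 := by
  obtain ⟨m, rfl⟩ := hp
  rw [nsmul_add, hRT.nsmul_left, zero_add, smul_neg, neg_ne_zero, add_nsmul, mul_nsmul,
    hRT.two_nsmul_right, nsmul_zero, zero_add, one_nsmul]
  exact hRT.right_ne_zero

lemma IsAdmissible.exists_translate_eq (hp : Odd p) (hRT : IsAdmissible p R T) :
    ∃ x y h, p • Point.some (W' := curve A B) x y h ≠ 0 ∧
      ∀ k, translate T (dualAdd A B (infPt k) (liftPt R)) = ⟦dualShift A k x y⟧ := by
  have hW := hRT.nsmul_sub_ne_zero hp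
  match R, T with
  | .zero, _ => exact absurd (nsmul_zero 2) hRT.two_nsmul_left
  | _, .zero => exact absurd rfl hRT.right_ne_zero
  | .some x₁ y₁ h₁, .some x₂ y₂ h₂ =>
    have hx : x₁ ≠ x₂ := by
      refine fun hx => hRT.two_nsmul_left ?_
      obtain hR | hR := (Point.X_eq_iff (h₁ := h₁) (h₂ := h₂)).mp hx
      · rw [hR, hRT.two_nsmul_right]
      · rw [hR, smul_neg, hRT.two_nsmul_right, neg_zero]
    obtain ⟨h₂', hneg⟩ := neg_some h₂
    obtain ⟨x₃, y₃, h₃, hadd, hshift⟩ := dualAdd_dualShift_liftPt h₁ h₂' hx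
    rw [hneg, hadd] at hW
    refine ⟨x₃, y₃, h₃, hW, fun k => ?_⟩
    rw [dualAdd_infPt_liftPt_some, translate, hneg, hshift]

lemma pointDivisor_apply_eq_zero (hP : p • P = 0) (hW : p • W ≠ 0) : pointDivisor P W = 0 := by
  rw [pointDivisor_apply_of_ne_zero (by rintro rfl; exact hW (nsmul_zero p)),
    Finsupp.single_eq_of_ne (by rintro rfl; exact hW hP)]

lemma hNum_ne_zero (h2 : (2 : K) ≠ 0) (hP : p • P = 0) (hW : p • Point.some x y h ≠ 0)
    (i j : ℕ) : hNum p P i j 0 * x + hNum p P i j 1 * y + hNum p P i j 2 ≠ 0 := by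
  have hi : p • i • P = 0 := by rw [nsmul_left_comm, hP, nsmul_zero]
  have hj : p • j • P = 0 := by rw [nsmul_left_comm, hP, nsmul_zero]
  rw [hNum]
  split_ifs
  · refine (hasDivisor_vertical h2 (i • P)).value_ne_zero ?_ (hasValueAt_formFun _ h)
    rw [Finsupp.add_apply, pointDivisor_apply_eq_zero hi hW,
      pointDivisor_apply_eq_zero (by rw [smul_neg, hi, neg_zero]) hW, add_zero]
  · refine (hasDivisor_line h2 (i • P) (j • P)).value_ne_zero ?_ (hasValueAt_formFun _ h)
    rw [Finsupp.add_apply, Finsupp.add_apply, pointDivisor_apply_eq_zero hi hW,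
      pointDivisor_apply_eq_zero hj hW, add_zero, zero_add, pointDivisor_apply_eq_zero _ hW]
    rw [smul_neg, nsmul_add, hi, hj, add_zero, neg_zero]

lemma hDen_ne_zero (h2 : (2 : K) ≠ 0) (hP : p • P = 0) (hW : p • Point.some x y h ≠ 0)
    (i j : ℕ) : hDen p P i j 0 * x + hDen p P i j 1 * y + hDen p P i j 2 ≠ 0 := by
  rw [hDen]
  split_ifs
  · simp
  · have hij : p • (i + j) • P = 0 := by rw [nsmul_left_comm, hP, nsmul_zero]
    refine (hasDivisor_vertical h2 ((i + j) • P)).value_ne_zero ?_ (hasValueAt_formFun _ h)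
    rw [Finsupp.add_apply, pointDivisor_apply_eq_zero hij hW,
      pointDivisor_apply_eq_zero (by rw [smul_neg, hij, neg_zero]) hW, add_zero]

lemma exists_hVal_eq (h2 : (2 : K) ≠ 0) (hP : p • P = 0) (hW : p • Point.some x y h ≠ 0)
    (i j : ℕ) : ∃ v ≠ 0, ∃ c, HasValueAt (logDer h2 (hFun p P i j)) (.some x y h) c ∧
      ∀ k Q, translate T Q = ⟦dualShift A k x y⟧ →
        hVal p T P i j Q = algebraMap K K[ε] v * (1 - (k * c) • DualNumber.eps) := by
  have hN := hNum_ne_zero h2 hP hW i j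
  have hD := hDen_ne_zero h2 hP hW i j
  refine ⟨_, div_ne_zero hN hD, _, ?_, fun k Q hQ => by rw [hVal, hQ, ratio_dualShift hN hD]⟩
  rw [hFun, logDer_div h2 ((hasValueAt_formFun _ h).ne_zero hN)
    ((hasValueAt_formFun _ h).ne_zero hD)]
  exact (hasValueAt_logDer_formFun h2 h hN).sub (hasValueAt_logDer_formFun h2 h hD)

lemma IsAdmissible.hDefined (h2 : (2 : K) ≠ 0) (hp : Odd p) (hRT : IsAdmissible p R T)
    (hP : p • P = 0) (i j : ℕ) (k : K) :
    HDefined p T P i j (dualAdd A B (infPt k) (liftPt R)) := by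
  obtain ⟨x, y, h, hW, hQ⟩ := hRT.exists_translate_eq hp
  have hD := hDen_ne_zero h2 hP hW i j
  rw [HDefined, hQ]
  refine ⟨dualShift_mem_dualPoints k h.1, ⟨_, _, rfl⟩, _, rfl, ?_⟩
  rw [evalForm_dualShift hD]
  exact isUnit_algebraMap_mul_one_sub_smul_eps hD _

lemma IsAdmissible.isUnit_hVal (h2 : (2 : K) ≠ 0) (hp : Odd p) (hRT : IsAdmissible p R T)
    (hP : p • P = 0) (i j : ℕ) (k : K) :
    IsUnit (hVal p T P i j (dualAdd A B (infPt k) (liftPt R))) := by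
  obtain ⟨x, y, h, hW, hQ⟩ := hRT.exists_translate_eq hp
  obtain ⟨v, hv, c, -, hval⟩ := exists_hVal_eq (T := T) h2 hP hW i j
  rw [hval k _ (hQ k)]
  exact isUnit_algebraMap_mul_one_sub_smul_eps hv _

lemma exists_hVal_mul_inverse_eq (h2 : (2 : K) ≠ 0) (hP : p • P = 0)
    (hW : p • Point.some x y h ≠ 0) (i j : ℕ) :
    ∃ c, HasValueAt (logDer h2 (hFun p P i j)) (.some x y h) c ∧
      ∀ k Q Q₀, translate T Q = ⟦dualShift A k x y⟧ → translate T Q₀ = ⟦dualShift A 0 x y⟧ →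
        hVal p T P i j Q * Ring.inverse (hVal p T P i j Q₀) =
          1 - (k * c) • DualNumber.eps := by
  obtain ⟨v, hv, c, hc, hval⟩ := exists_hVal_eq (T := T) h2 hP hW i j
  refine ⟨c, hc, fun k Q Q₀ hQ hQ₀ => ?_⟩
  rw [hval k Q hQ, hval 0 Q₀ hQ₀, inverse_algebraMap_mul_one_sub_smul_eps hv, mul_mul_mul_comm,
    ← map_mul, mul_inv_cancel₀ hv, one_sub_smul_eps_mul]
  simp

lemma exists_prod_hVal_eq (h2 : (2 : K) ≠ 0) (hP : p • P = 0) (hW : p • Point.some x y h ≠ 0)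
    (C : List (ℕ × ℕ)) :
    ∃ c, HasValueAt (logDer h2 (C.map fun s => hFun p P s.1 s.2).prod) (.some x y h) c ∧
      ∀ k Q Q₀, translate T Q = ⟦dualShift A k x y⟧ → translate T Q₀ = ⟦dualShift A 0 x y⟧ →
        (C.map fun s => hVal p T P s.1 s.2 Q * Ring.inverse (hVal p T P s.1 s.2 Q₀)).prod =
          1 - (k * c) • DualNumber.eps := by
  have hne (s : ℕ × ℕ) : hFun p P s.1 s.2 ≠ 0 := (hasDivisor_hFun h2 hP s.1 s.2).ne_zero h2
  induction C with
  | nil => exact ⟨0, by simpa [logDer_one] using HasValueAt.zero _, by simp⟩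
  | cons s C ih =>
    obtain ⟨c, hc, hprod⟩ := ih
    obtain ⟨d, hd, hval⟩ := exists_hVal_mul_inverse_eq (T := T) h2 hP hW s.1 s.2
    refine ⟨d + c, ?_, fun k Q Q₀ hQ hQ₀ => ?_⟩
    · rw [List.map_cons, List.prod_cons,
        logDer_mul h2 (hne s) (List.prod_ne_zero (by simpa using fun a b _ => hne (a, b)))]
      exact hd.add hc
    · rw [List.map_cons, List.prod_cons, hprod k Q Q₀ hQ hQ₀, hval k Q Q₀ hQ hQ₀,
        one_sub_smul_eps_mul, mul_add]

end Evaluation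

section Pairing

variable {K : Type*} [Field K] {p : ℕ} [CharP K p]

lemma odd_of_two_ne_zero [Fact p.Prime] (h2 : (2 : K) ≠ 0) : Odd p :=
  (Fact.out : p.Prime).odd_of_ne_two (by rintro rfl; exact h2 (CharP.cast_eq_zero K 2))

variable [IsAlgClosed K] [DecidableEq K] [Fact p.Prime] {A B c : K} {h2 : (2 : K) ≠ 0}
  {P P' R R' T T' : (curve A B).Point} {C C' : List (ℕ × ℕ)}

theorem pairing_infPt_eq (hE : 4 * A ^ 3 + 27 * B ^ 2 ≠ 0) (hRT : IsAdmissible p R T)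
    (hC : IsChainDecomposition p C) (hP : p • P = 0) (hc : HasLogDer h2 p P c) (k : K) :
    pairing p R T C P (infPt k) = 1 - (k * c) • DualNumber.eps := by
  obtain rfl | hk := eq_or_ne k 0
  · simp [pairing]
  obtain rfl | hP0 := eq_or_ne P 0
  · simp [pairing, hc.unique hE .zero]
  obtain ⟨x, y, h, hW, hQ⟩ := hRT.exists_translate_eq (odd_of_two_ne_zero h2)
  have hQ₀ := hQ 0
  rw [dualAdd_infPt_zero_liftPt] at hQ₀
  obtain ⟨d, hd, hprod⟩ := exists_prod_hVal_eq (T := T) h2 hP hW C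
  rw [hc.logDer_eq hE (sum_pointDivisor P) (sum_pointDivisor_smul P) (hC.hasDivisor h2 hP)] at hd
  rw [pairing, if_neg (not_or.mpr ⟨hP0, infPt_injective.ne hk⟩), hprod k _ _ (hQ k) hQ₀,
    hd.unique (.const _ c)]

theorem pairing_pow_eq_one (h2 : (2 : K) ≠ 0) (hE : 4 * A ^ 3 + 27 * B ^ 2 ≠ 0)
    (hRT : IsAdmissible p R T) (hC : IsChainDecomposition p C) (hP : p • P = 0) (k : K) :
    pairing p R T C P (infPt k) ^ p = 1 := by
  obtain ⟨c, hc⟩ := exists_hasLogDer h2 hE hP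
  rw [pairing_infPt_eq hE hRT hC hP hc, one_sub_smul_eps_pow, CharP.cast_eq_zero, zero_mul,
    zero_smul, sub_zero]

theorem pairing_infPt_eq_pairing_infPt (h2 : (2 : K) ≠ 0) (hE : 4 * A ^ 3 + 27 * B ^ 2 ≠ 0)
    (hRT : IsAdmissible p R T) (hRT' : IsAdmissible p R' T') (hC : IsChainDecomposition p C)
    (hC' : IsChainDecomposition p C') (hP : p • P = 0) (k : K) :
    pairing p R T C P (infPt k) = pairing p R' T' C' P (infPt k) := by
  obtain ⟨c, hc⟩ := exists_hasLogDer h2 hE hP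
  rw [pairing_infPt_eq hE hRT hC hP hc, pairing_infPt_eq hE hRT' hC' hP hc]

theorem pairing_add_infPt (h2 : (2 : K) ≠ 0) (hE : 4 * A ^ 3 + 27 * B ^ 2 ≠ 0)
    (hRT : IsAdmissible p R T) (hC : IsChainDecomposition p C) (hP : p • P = 0)
    (hP' : p • P' = 0) (k : K) :
    pairing p R T C (P + P') (infPt k) =
      pairing p R T C P (infPt k) * pairing p R T C P' (infPt k) := by
  obtain ⟨c, hc⟩ := exists_hasLogDer h2 hE hP
  obtain ⟨c', hc'⟩ := exists_hasLogDer h2 hE hP'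
  rw [pairing_infPt_eq hE hRT hC (by rw [nsmul_add, hP, hP', add_zero]) (hc.add hc'),
    pairing_infPt_eq hE hRT hC hP hc, pairing_infPt_eq hE hRT hC hP' hc', one_sub_smul_eps_mul,
    mul_add]

theorem pairing_dualAdd_infPt (h2 : (2 : K) ≠ 0) (hE : 4 * A ^ 3 + 27 * B ^ 2 ≠ 0)
    (hRT : IsAdmissible p R T) (hC : IsChainDecomposition p C) (hP : p • P = 0) (k k' : K) :
    pairing p R T C P (dualAdd A B (infPt k) (infPt k')) =
      pairing p R T C P (infPt k) * pairing p R T C P (infPt k') := by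
  obtain ⟨c, hc⟩ := exists_hasLogDer h2 hE hP
  simp only [dualAdd_infPt_infPt, pairing_infPt_eq hE hRT hC hP hc, one_sub_smul_eps_mul, add_mul]

theorem exists_hasValueAt_and_pairing_infPt_eq (h2 : (2 : K) ≠ 0)
    (hE : 4 * A ^ 3 + 27 * B ^ 2 ≠ 0) (hRT : IsAdmissible p R T)
    (hC : IsChainDecomposition p C) (hP : p • P = 0) {D : (curve A B).Point →₀ ℤ}
    (hdeg : (D.sum fun _ n => n) = 0) (hsum : (D.sum fun X n => n • X) = P)
    {f : (curve A B).FunctionField} (hf : HasDivisor f (p • D)) (X : (curve A B).Point) :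
    ∃ c, HasValueAt (yF A B * (ddx A B h2 f / f)) X c ∧
      ∀ k, pairing p R T C P (infPt k) = 1 - (2 * c * k) • DualNumber.eps := by
  obtain ⟨c, hc⟩ := exists_hasLogDer h2 hE hP
  refine ⟨c / 2, ?_, fun k => ?_⟩
  · rw [yF_mul_ddx_div, hc.logDer_eq hE hdeg hsum hf, ← map_ofNat (algebraMap K _) 2,
      ← map_div₀]
    exact .const X _
  · rw [pairing_infPt_eq hE hRT hC hP hc, mul_div_cancel₀ c h2, mul_comm]

end Pairing

end DualPairing

theorem theorem1 {K : Type*} [Field K] [IsAlgClosed K] [DecidableEq K]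
    (p : ℕ) [Fact p.Prime] [CharP K p] (h2 : (2 : K) ≠ 0) (h3 : (3 : K) ≠ 0)
    (A B : K) (hE : 4 * A ^ 3 + 27 * B ^ 2 ≠ 0)
    (R T : (curve A B).Point) (hR : p • R = 0) (hR2 : 2 • R ≠ 0)
    (hT : 2 • T = 0) (hT0 : T ≠ 0) :
    -- the map `e` is well defined: the values in the product make sense, and the values of `e`
    -- lie in `μ_p(K[ε])`
    (∀ C, IsChainDecomposition p C → ∀ P : (curve A B).Point, p • P = 0 → ∀ Q ∈ Θ K,
      dualAdd A B Q (liftPt R) ∈ dualPoints A B ∧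
      (P ≠ 0 → Q ≠ infPt 0 → ∀ s ∈ C,
        HDefined p T P s.1 s.2 (dualAdd A B Q (liftPt R)) ∧
        HDefined p T P s.1 s.2 (liftPt R) ∧
        IsUnit (hVal p T P s.1 s.2 (liftPt R))) ∧
      pairing p R T C P Q ^ p = 1) ∧
    -- the map `e` is independent of the addition chain decomposition
    (∀ C C', IsChainDecomposition p C → IsChainDecomposition p C' →
      ∀ P : (curve A B).Point, p • P = 0 → ∀ Q ∈ Θ K,
        pairing p R T C P Q = pairing p R T C' P Q) ∧
    -- the map `e` is bilinear
    (∀ C, IsChainDecomposition p C →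
      (∀ P P' : (curve A B).Point, p • P = 0 → p • P' = 0 → ∀ Q ∈ Θ K,
        pairing p R T C (P + P') Q = pairing p R T C P Q * pairing p R T C P' Q) ∧
      (∀ P : (curve A B).Point, p • P = 0 → ∀ Q ∈ Θ K, ∀ Q' ∈ Θ K,
        dualAdd A B Q Q' ∈ Θ K ∧
        pairing p R T C P (dualAdd A B Q Q') = pairing p R T C P Q * pairing p R T C P Q')) ∧
    -- the formula for `e`, with any divisor of degree zero that sums to `P` and any point `R'`
    (∀ C, IsChainDecomposition p C → ∀ P : (curve A B).Point, p • P = 0 →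
      ∀ D : (curve A B).Point →₀ ℤ, (D.sum fun _ n => n) = 0 → (D.sum fun X n => n • X) = P →
      ∀ f : (curve A B).FunctionField, HasDivisor f (p • D) →
      ∀ R' : (curve A B).Point, ∃ c : K, HasValueAt (yF A B * (ddx A B h2 f / f)) R' c ∧
        ∀ k : K, pairing p R T C P (infPt k) = 1 - (2 * c * k) • DualNumber.eps) ∧
    -- the map `e` depends neither on `R` nor on `T`
    (∀ R' T' : (curve A B).Point, p • R' = 0 → 2 • R' ≠ 0 → 2 • T' = 0 → T' ≠ 0 →
      ∀ C, IsChainDecomposition p C → ∀ P : (curve A B).Point, p • P = 0 → ∀ Q ∈ Θ K,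
        pairing p R' T' C P Q = pairing p R T C P Q) := by
  have hodd : Odd p := odd_of_two_ne_zero h2
  have hRT : IsAdmissible p R T := ⟨hR, hR2, hT, hT0⟩
  refine ⟨?_, ?_, fun C hC => ⟨?_, ?_⟩, ?_, ?_⟩
  · rintro C hC P hP _ ⟨k, rfl⟩
    have hunit (i j : ℕ) : IsUnit (hVal p T P i j (liftPt R)) :=
      dualAdd_infPt_zero_liftPt R ▸ hRT.isUnit_hVal h2 hodd hP i j 0
    have hdef (i j : ℕ) : HDefined p T P i j (liftPt R) :=
      dualAdd_infPt_zero_liftPt R ▸ hRT.hDefined h2 hodd hP i j 0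
    exact ⟨dualAdd_infPt_liftPt_mem_dualPoints k R,
      fun _ _ s _ => ⟨hRT.hDefined h2 hodd hP s.1 s.2 k, hdef s.1 s.2, hunit s.1 s.2⟩,
      pairing_pow_eq_one h2 hE hRT hC hP k⟩
  · rintro C C' hC hC' P hP _ ⟨k, rfl⟩
    exact pairing_infPt_eq_pairing_infPt h2 hE hRT hRT hC hC' hP k
  · rintro P P' hP hP' _ ⟨k, rfl⟩
    exact pairing_add_infPt h2 hE hRT hC hP hP' k
  · rintro P hP _ ⟨k, rfl⟩ _ ⟨k', rfl⟩
    exact ⟨⟨k + k', (dualAdd_infPt_infPt k k').symm⟩, pairing_dualAdd_infPt h2 hE hRT hC hP k k'⟩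
  · exact fun C hC P hP D hdeg hsum f hf R' =>
      exists_hasValueAt_and_pairing_infPt_eq h2 hE hRT hC hP hdeg hsum hf R'
  · rintro R' T' hR' hR2' hT' hT0' C hC P hP _ ⟨k, rfl⟩
    exact pairing_infPt_eq_pairing_infPt h2 hE ⟨hR', hR2', hT', hT0'⟩ hRT hC hC hP k
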